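/- All systems are finite-dimensional. A bipartite state is a density matrix (positive semidefinite, trace one) on $\mathcal H_A\otimes\mathcal H_B$, with $A$ held by Alice and $B$ by Bob; tensor products of bipartite states are again regarded as bipartite by grouping all of Alice's systems and all of Bob's systems. An LOCC protocol is a finite-round protocol of local operations and classical communication between Alice and Bob: in each round one party performs a measurement, given by finitely many Kraus operators $K_i$ with $\sum_i K_i^\dagger K_i=\mathbb 1$, on its own system and announces the outcome, on which all later rounds may depend; the outcomes are forgotten at the end. Let $\|M\|_1=\mathrm{Tr}\sqrt{M^\dagger M}$. Let $\rho$ be a state of a bipartite system and $\sigma$ a state of a (possibly different) bipartite system $S$, and let $r\in\mathbb R$. Below, $m\ge 0$ and $n\ge 1$ are integers, and $S_1,\dots,S_m$ are copies of $S$; a superscript on a state denotes the reduced state on the indicated systems. - An asymptotic transformation from $\rho$ to $\sigma$ is possible at rate $r$ if for all $\varepsilon,\delta>0$ there are $m,n$ and an LOCC protocol $\Lambda$ with $\|\Lambda(\rho^{\otimes n})-\sigma^{\otimes m}\|_1<\varepsilon$ and $\frac mn+\delta>r$. The supremum of such $r$ is the transformation rate $R(\rho\to\sigma)$. - A marginal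 asymptotic transformation from $\rho$ to $\sigma$ is possible at rate $r$ if for all $\varepsilon,\delta>0$ there are $m,n$ and an LOCC protocol $\Lambda$ such that $\mu^{S_1\ldots S_m}=\Lambda(\rho^{\otimes n})$ satisfies $\|\mu^{S_i}-\sigma\|_1<\varepsilon$ for all $i\le m$, and $\frac mn+\delta>r$. The supremum of such $r$ is the marginal transformation rate $R_{\mathrm m}(\rho\to\sigma)$. - A marginal asymptotic transformation with correlated catalysis from $\rho$ to $\sigma$ is possible at rate $r$ if for all $\varepsilon,\delta>0$ there are $m,n$, a bipartite state $\tau^C$ of some bipartite system $C$ (the catalyst) and an LOCC protocol $\Lambda$ such that $\mu^{S_1\ldots S_mC}=\Lambda(\rho^{\otimes n}\otimes\tau^C)$ satisfies $\|\mu^{S_i}-\sigma\|_1<\varepsilon$ for all $i\le m$, $\mu^C=\tau^C$, and $\frac mn+\delta>r$. The supremum of such $r$ is the marginal catalytic transformation rate $R_{\mathrm{mc}}(\rho\to\sigma)$. Suprema are taken in $[-\infty,\infty]$. A bipartite state $\rho$ is called distillable if $R(\rho\to\psi^-)>0$, where $\psi^-$ is the singlet, i.e. the pure two-qubit state $(|01\rangle-|10\rangle)/\sqrt2$.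 **Proposition.** For any two bipartite distillable states $\rho$ and $\sigma$, $$R_{\mathrm{mc}}(\rho\to\sigma)=R_{\mathrm m}(\rho\to\sigma).$$ -/

import Mathlib

open scoped Matrix Kronecker ComplexOrder

noncomputable section

namespace LOCCRates

/-- The trace norm `‖M‖₁ = Tr √(Mᴴ M)`, i.e. the sum of the square roots of the eigenvalues
of `Mᴴ M` (counted with multiplicity). -/
def traceNorm {I : Type} [Fintype I] [DecidableEq I] (M : Matrix I I ℂ) : ℝ :=
  ∑ i, Real.sqrt ((Matrix.isHermitian_conjTranspose_mul_self M).eigenvalues i)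

/-- Density matrices. The index type labels an orthonormal basis; a bipartite state, with
Alice holding a system with basis `A` and Bob one with basis `B`, is indexed by `A × B`. -/
def IsState {I : Type} [Fintype I] (ρ : Matrix I I ℂ) : Prop :=
  ρ.PosSemidef ∧ ρ.trace = 1

/-- `IsLOCC Λ`: the map `Λ` is implemented by a protocol of local operations and classical
communication with finitely many rounds. A protocol is a finite tree: in each round one party
performs a measurement with Kraus operators `K i` on its own system (its system after
outcome `i`, with basis `E i`, may depend on `i`), announces `i`, and the parties go on with
an LOCC protocol `Λ i` that may depend on `i`. The final record of outcomes is forgotten.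
A local channel is the case in which `Λ i` does not depend on `i`. -/
inductive IsLOCC {A' B' : Type} [Fintype A'] [DecidableEq A'] [Fintype B'] [DecidableEq B'] :
    ∀ {A B : Type} [Fintype A] [DecidableEq A] [Fintype B] [DecidableEq B],
      (Matrix (A × B) (A × B) ℂ → Matrix (A' × B') (A' × B') ℂ) → Prop
  | done : IsLOCC (A := A') (B := B') (fun X => X)
  | alice {A B : Type} [Fintype A] [DecidableEq A] [Fintype B] [DecidableEq B]
      {ι : Type} [Fintype ι] {E : ι → Type} [∀ i, Fintype (E i)] [∀ i, DecidableEq (E i)]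
      (K : ∀ i, Matrix (E i) A ℂ) (hK : ∑ i, (K i)ᴴ * K i = 1)
      (Λ : ∀ i, Matrix (E i × B) (E i × B) ℂ → Matrix (A' × B') (A' × B') ℂ)
      (hΛ : ∀ i, IsLOCC (Λ i)) :
      IsLOCC (fun X : Matrix (A × B) (A × B) ℂ =>
        ∑ i, Λ i ((K i ⊗ₖ (1 : Matrix B B ℂ)) * X * (K i ⊗ₖ (1 : Matrix B B ℂ))ᴴ))
  | bob {A B : Type} [Fintype A] [DecidableEq A] [Fintype B] [DecidableEq B]
      {ι : Type} [Fintype ι] {E : ι → Type} [∀ i, Fintype (E i)] [∀ i, DecidableEq (E i)]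
      (K : ∀ i, Matrix (E i) B ℂ) (hK : ∑ i, (K i)ᴴ * K i = 1)
      (Λ : ∀ i, Matrix (A × E i) (A × E i) ℂ → Matrix (A' × B') (A' × B') ℂ)
      (hΛ : ∀ i, IsLOCC (Λ i)) :
      IsLOCC (fun X : Matrix (A × B) (A × B) ℂ =>
        ∑ i, Λ i (((1 : Matrix A A ℂ) ⊗ₖ K i) * X * ((1 : Matrix A A ℂ) ⊗ₖ K i)ᴴ))

/-- `ρ^{⊗ n}` as a bipartite state: Alice holds the `n` copies of `A`, Bob those of `B`. -/
def copies {A B : Type} (ρ : Matrix (A × B) (A × B) ℂ) (n : ℕ) :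
    Matrix ((Fin n → A) × (Fin n → B)) ((Fin n → A) × (Fin n → B)) ℂ :=
  fun x y => ∏ i, ρ (x.1 i, x.2 i) (y.1 i, y.2 i)

/-- `ρ ⊗ τ` for two bipartite states, regrouped into Alice's and Bob's parts. -/
def withCatalyst {A B C D : Type} (ρ : Matrix (A × B) (A × B) ℂ)
    (τ : Matrix (C × D) (C × D) ℂ) : Matrix ((A × C) × (B × D)) ((A × C) × (B × D)) ℂ :=
  fun x y => ρ (x.1.1, x.2.1) (y.1.1, y.2.1) * τ (x.1.2, x.2.2) (y.1.2, y.2.2)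

/-- The reduced state `μ^S` of `μ^{SC}`: the catalyst is traced out. -/
def systemPart {A B C D : Type} [Fintype C] [Fintype D]
    (μ : Matrix ((A × C) × (B × D)) ((A × C) × (B × D)) ℂ) : Matrix (A × B) (A × B) ℂ :=
  fun x y => ∑ c : C, ∑ d : D, μ ((x.1, c), (x.2, d)) ((y.1, c), (y.2, d))

/-- The reduced state `μ^C` of `μ^{SC}`: the system is traced out. -/
def catalystPart {A B C D : Type} [Fintype A] [Fintype B]
    (μ : Matrix ((A × C) × (B × D)) ((A × C) × (B × D)) ℂ) : Matrix (C × D) (C × D) ℂ :=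
  fun x y => ∑ a : A, ∑ b : B, μ ((a, x.1), (b, x.2)) ((a, y.1), (b, y.2))

/-- The reduced state `μ^{S_i}` of `μ^{S_1 … S_m}`: the sum runs over the basis labels `u`, `v`
of Alice's and Bob's systems with `i`-th entries the row index `x`; the column index agrees with
them except in the `i`-th entries, which are `y`. -/
def marginal {A B : Type} [Fintype A] [DecidableEq A] [Fintype B] [DecidableEq B] {m : ℕ}
    (μ : Matrix ((Fin m → A) × (Fin m → B)) ((Fin m → A) × (Fin m → B)) ℂ) (i : Fin m) :
    Matrix (A × B) (A × B) ℂ :=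
  fun x y => ∑ u : Fin m → A, ∑ v : Fin m → B,
    if u i = x.1 ∧ v i = x.2 then
      μ (u, v) (Function.update u i y.1, Function.update v i y.2) else 0

/-- The vector `(|01⟩ - |10⟩) / √2`. -/
def singletVec : Fin 2 × Fin 2 → ℂ := fun x =>
  if x = (0, 1) then ((Real.sqrt 2 : ℝ) : ℂ)⁻¹
  else if x = (1, 0) then -((Real.sqrt 2 : ℝ) : ℂ)⁻¹ else 0

/-- The singlet, as a density matrix of two qubits. -/
def singlet : Matrix (Fin 2 × Fin 2) (Fin 2 × Fin 2) ℂ :=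
  Matrix.vecMulVec singletVec (star singletVec)

section Rates

variable {A B A' B' : Type} [Fintype A] [DecidableEq A] [Fintype B] [DecidableEq B]
  [Fintype A'] [DecidableEq A'] [Fintype B'] [DecidableEq B']

/-- An asymptotic transformation from `ρ` into `σ` is possible at rate `r`. -/
def Achievable (ρ : Matrix (A × B) (A × B) ℂ) (σ : Matrix (A' × B') (A' × B') ℂ)
    (r : ℝ) : Prop :=
  ∀ ε : ℝ, 0 < ε → ∀ δ : ℝ, 0 < δ → ∃ m n : ℕ, 0 < n ∧
    ∃ Λ : Matrix ((Fin n → A) × (Fin n → B)) ((Fin n → A) × (Fin n → B)) ℂ →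
        Matrix ((Fin m → A') × (Fin m → B')) ((Fin m → A') × (Fin m → B')) ℂ,
      IsLOCC Λ ∧
      traceNorm (Λ (copies ρ n) - copies σ m) < ε ∧
      r < (m : ℝ) / (n : ℝ) + δ

/-- A marginal asymptotic transformation from `ρ` to `σ` is possible at rate `r`. -/
def MarginalAchievable (ρ : Matrix (A × B) (A × B) ℂ) (σ : Matrix (A' × B') (A' × B') ℂ)
    (r : ℝ) : Prop :=
  ∀ ε : ℝ, 0 < ε → ∀ δ : ℝ, 0 < δ → ∃ m n : ℕ, 0 < n ∧
    ∃ Λ : Matrix ((Fin n → A) × (Fin n → B)) ((Fin n → A) × (Fin n → B)) ℂ →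
        Matrix ((Fin m → A') × (Fin m → B')) ((Fin m → A') × (Fin m → B')) ℂ,
      IsLOCC Λ ∧
      (∀ i, traceNorm (marginal (Λ (copies ρ n)) i - σ) < ε) ∧
      r < (m : ℝ) / (n : ℝ) + δ

/-- A marginal asymptotic transformation with correlated catalysis from `ρ` to `σ` is possible
at rate `r`. The catalyst is an arbitrary bipartite state of finite dimensions `c`, `d`. -/
def MarginalCatalyticAchievable (ρ : Matrix (A × B) (A × B) ℂ)
    (σ : Matrix (A' × B') (A' × B') ℂ) (r : ℝ) : Prop :=
  ∀ ε : ℝ, 0 < ε → ∀ δ : ℝ, 0 < δ → ∃ m n : ℕ, 0 < n ∧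
    ∃ (c d : ℕ) (τ : Matrix (Fin c × Fin d) (Fin c × Fin d) ℂ), IsState τ ∧
    ∃ Λ : Matrix (((Fin n → A) × Fin c) × ((Fin n → B) × Fin d))
            (((Fin n → A) × Fin c) × ((Fin n → B) × Fin d)) ℂ →
          Matrix (((Fin m → A') × Fin c) × ((Fin m → B') × Fin d))
            (((Fin m → A') × Fin c) × ((Fin m → B') × Fin d)) ℂ,
      IsLOCC Λ ∧
      (∀ i, traceNorm (marginal (systemPart (Λ (withCatalyst (copies ρ n) τ))) i - σ) < ε) ∧
      catalystPart (Λ (withCatalyst (copies ρ n) τ)) = τ ∧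
      r < (m : ℝ) / (n : ℝ) + δ

/-- The transformation rate `R(ρ → σ)`. -/
def rate (ρ : Matrix (A × B) (A × B) ℂ) (σ : Matrix (A' × B') (A' × B') ℂ) : EReal :=
  ⨆ (r : ℝ) (_ : Achievable ρ σ r), (r : EReal)

/-- The marginal transformation rate `R_m(ρ → σ)`. -/
def marginalRate (ρ : Matrix (A × B) (A × B) ℂ) (σ : Matrix (A' × B') (A' × B') ℂ) : EReal :=
  ⨆ (r : ℝ) (_ : MarginalAchievable ρ σ r), (r : EReal)

/-- The marginal catalytic transformation rate `R_mc(ρ → σ)`. -/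
def marginalCatalyticRate (ρ : Matrix (A × B) (A × B) ℂ)
    (σ : Matrix (A' × B') (A' × B') ℂ) : EReal :=
  ⨆ (r : ℝ) (_ : MarginalCatalyticAchievable ρ σ r), (r : EReal)

/-- A state is distillable if it can be converted into singlets at a nonzero rate. -/
def Distillable (ρ : Matrix (A × B) (A × B) ℂ) : Prop :=
  0 < rate ρ singlet

end Rates

end LOCCRates

end

/-!
A one-dimensional catalyst, left untouched, gives `R_m ≤ R_mc`.

For `R_mc ≤ R_m`, the catalyst is not given for free but has to be produced from `ρ`. Since `ρ` is
distillable, finitely many copies of it yield singlets of any quality, and teleporting a locally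
prepared system through them yields an approximation of any bipartite state, in particular of the
catalyst `τ`. If `n₀` copies suffice for the desired accuracy, spend them on `τ` and then run the
catalytic protocol `k` times, each time on `n` fresh copies. Every run returns the reduced state of
the catalyst exactly; the correlations it may have with earlier outputs do not matter, because
only the marginals of the single output systems are tested. The error of the approximate catalyst
enters once and is not amplified by LOCC, and the rate `m k / (n k + n₀)` tends to `m / n`.
-/

namespace LOCCRates

section TraceNorm

open scoped MatrixOrder Matrix.Norms.L2Operator

variable {I J : Type} [Fintype I] [Fintype J]

lemma re_trace_mul_nonneg {P Q : Matrix I I ℂ} (hP : P.PosSemidef) (hQ : Q.PosSemidef) :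
    0 ≤ (P * Q).trace.re := by
  classical
  obtain ⟨B, rfl⟩ := CStarAlgebra.nonneg_iff_eq_star_mul_self.1 hP.nonneg
  rw [Matrix.mul_assoc, Matrix.trace_mul_comm]
  exact (Complex.le_def.1 (hQ.mul_mul_conjTranspose_same B).trace_nonneg).1

variable [DecidableEq I] [DecidableEq J]

lemma trace_cfc {M : Matrix I I ℂ} (hM : M.IsHermitian) (f : ℝ → ℝ) :
    (cfc f M).trace = ∑ i, (f (hM.eigenvalues i) : ℂ) := by
  rw [hM.cfc_eq, Matrix.IsHermitian.cfc, Unitary.conjStarAlgAut_apply, Matrix.trace_mul_comm,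
    ← mul_assoc, Unitary.coe_star_mul_self, one_mul, Matrix.trace_diagonal]
  rfl

lemma traceNorm_eq_re_trace_abs (M : Matrix I I ℂ) : traceNorm M = (CFC.abs M).trace.re := by
  rw [CFC.abs, CFC.sqrt_eq_real_sqrt _ (star_mul_self_nonneg M), cfcₙ_eq_cfc,
    Matrix.star_eq_conjTranspose, trace_cfc (Matrix.isHermitian_conjTranspose_mul_self M),
    Complex.re_sum]
  rfl

lemma exists_traceNorm_eq_re_trace_mul {M : Matrix I I ℂ} (hM : M.IsHermitian) :
    ∃ S : Matrix I I ℂ, (1 + S).PosSemidef ∧ (1 - S).PosSemidef ∧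
      traceNorm M = (M * S).trace.re := by
  have hsa : IsSelfAdjoint M := hM
  have hcont (f : ℝ → ℝ) : ContinuousOn f (spectrum ℝ M) := M.finite_real_spectrum.continuousOn f
  let sgn : ℝ → ℝ := fun x => SignType.sign x
  have hle : cfc sgn M ≤ 1 := cfc_le_one sgn M fun x _ => by
    dsimp only [sgn]
    cases SignType.sign x <;> norm_num
  have hge : algebraMap ℝ (Matrix I I ℂ) (-1) ≤ cfc sgn M :=
    algebraMap_le_cfc sgn (-1) M (fun x _ => by
      dsimp only [sgn]
      cases SignType.sign x <;> norm_num) (hcont sgn) hsa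
  have habs : M * cfc sgn M = CFC.abs M := by
    conv_lhs => enter [1]; rw [← cfc_id' ℝ M hsa]
    rw [← cfc_mul _ sgn M (hcont _) (hcont sgn), CFC.abs_eq_cfc_norm M hsa]
    simp only [sgn, self_mul_sign, Real.norm_eq_abs]
  refine ⟨cfc sgn M, ?_, hle, by rw [habs, traceNorm_eq_re_trace_abs]⟩
  rw [add_comm, ← sub_neg_eq_add, ← map_one (algebraMap ℝ _), ← map_neg]
  exact hge

lemma traceNorm_sub_le {P Q : Matrix I I ℂ} (hP : P.PosSemidef) (hQ : Q.PosSemidef) :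
    traceNorm (P - Q) ≤ P.trace.re + Q.trace.re := by
  obtain ⟨S, hS, hS', hPQ⟩ := exists_traceNorm_eq_re_trace_mul (hP.isHermitian.sub hQ.isHermitian)
  have hPS := re_trace_mul_nonneg hP hS'
  have hQS := re_trace_mul_nonneg hQ hS
  simp only [mul_sub, mul_add, Matrix.sub_mul, mul_one, Matrix.trace_add,
    Matrix.trace_sub, Complex.add_re, Complex.sub_re] at hPQ hPS hQS
  linarith

lemma exists_posSemidef_sub_eq {M : Matrix I I ℂ} (hM : M.IsHermitian) :
    ∃ P Q : Matrix I I ℂ, P.PosSemidef ∧ Q.PosSemidef ∧ M = P - Q ∧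
      traceNorm M = P.trace.re + Q.trace.re :=
  ⟨M⁺, M⁻, Matrix.nonneg_iff_posSemidef.1 (CFC.posPart_nonneg M),
    Matrix.nonneg_iff_posSemidef.1 (CFC.negPart_nonneg M), (CFC.posPart_sub_negPart M hM).symm, by
      rw [traceNorm_eq_re_trace_abs, ← CFC.posPart_add_negPart M hM, Matrix.trace_add,
        Complex.add_re]⟩

lemma traceNorm_add_le {M N : Matrix I I ℂ} (hM : M.IsHermitian) (hN : N.IsHermitian) :
    traceNorm (M + N) ≤ traceNorm M + traceNorm N := by
  obtain ⟨P, Q, hP, hQ, rfl, hPQ⟩ := exists_posSemidef_sub_eq hM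
  obtain ⟨P', Q', hP', hQ', rfl, hPQ'⟩ := exists_posSemidef_sub_eq hN
  rw [hPQ, hPQ', sub_add_sub_comm]
  refine (traceNorm_sub_le (hP.add hP') (hQ.add hQ')).trans_eq ?_
  simp only [Matrix.trace_add, Complex.add_re]
  ring

lemma traceNorm_zero : traceNorm (0 : Matrix I I ℂ) = 0 := by
  rw [traceNorm_eq_re_trace_abs, CFC.abs_zero, Matrix.trace_zero, Complex.zero_re]

lemma traceNorm_map_le {F : Matrix I I ℂ → Matrix J J ℂ} (hF : IsLinearMap ℂ F)
    (hpos : ∀ X, X.PosSemidef → (F X).PosSemidef) (htr : ∀ X, (F X).trace = X.trace)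
    {M : Matrix I I ℂ} (hM : M.IsHermitian) : traceNorm (F M) ≤ traceNorm M := by
  obtain ⟨P, Q, hP, hQ, rfl, hPQ⟩ := exists_posSemidef_sub_eq hM
  rw [hPQ, hF.map_sub, ← htr P, ← htr Q]
  exact traceNorm_sub_le (hpos P hP) (hpos Q hQ)

end TraceNorm

section Blocks

variable {A B C D E F A' B' : Type}

/-- Relabelling of the basis vectors of the two parties. -/
def relabel (f : A ≃ A') (g : B ≃ B') (X : Matrix (A × B) (A × B) ℂ) :
    Matrix (A' × B') (A' × B') ℂ :=
  Matrix.reindex (f.prodCongr g) (f.prodCongr g) X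

/-- Interchange of the two factors of a bipartite tensor product. -/
def swapParts (X : Matrix ((A × C) × (B × D)) ((A × C) × (B × D)) ℂ) :
    Matrix ((C × A) × (D × B)) ((C × A) × (D × B)) ℂ :=
  relabel (Equiv.prodComm A C) (Equiv.prodComm B D) X

/-- The block of a matrix on a bipartite tensor product obtained by fixing the row index `p` and
the column index `q` of the second factor. -/
def block (X : Matrix ((A × C) × (B × D)) ((A × C) × (B × D)) ℂ) (p q : C × D) :
    Matrix (A × B) (A × B) ℂ :=
  X.submatrix (fun z => ((z.1, p.1), (z.2, p.2))) (fun z => ((z.1, q.1), (z.2, q.2)))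

/-- The map `Λ ⊗ id`, which leaves a second bipartite system `E × F` untouched. -/
def withIdle (E F : Type) (Λ : Matrix (A × B) (A × B) ℂ → Matrix (A' × B') (A' × B') ℂ)
    (X : Matrix ((A × E) × (B × F)) ((A × E) × (B × F)) ℂ) :
    Matrix ((A' × E) × (B' × F)) ((A' × E) × (B' × F)) ℂ :=
  fun x y => Λ (block X (x.1.2, x.2.2) (y.1.2, y.2.2)) (x.1.1, x.2.1) (y.1.1, y.2.1)

lemma relabel_apply (f : A ≃ A') (g : B ≃ B') (X : Matrix (A × B) (A × B) ℂ) (a a' : A)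
    (b b' : B) : relabel f g X (f a, g b) (f a', g b') = X (a, b) (a', b') := by
  simp only [relabel, Matrix.reindex_apply, Matrix.submatrix_apply, Equiv.prodCongr_symm,
    Equiv.prodCongr_apply, Prod.map_apply, Equiv.symm_apply_apply]

lemma relabel_symm_relabel (f : A ≃ A') (g : B ≃ B') (X : Matrix (A × B) (A × B) ℂ) :
    relabel f.symm g.symm (relabel f g X) = X :=
  Matrix.ext fun x y => relabel_apply f g X x.1 y.1 x.2 y.2

lemma ext_block {X Y : Matrix ((A × C) × (B × D)) ((A × C) × (B × D)) ℂ}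
    (h : ∀ p q, block X p q = block Y p q) : X = Y := by
  ext ⟨⟨a, c⟩, ⟨b, d⟩⟩ ⟨⟨a', c'⟩, ⟨b', d'⟩⟩
  exact congrFun₂ (h (c, d) (c', d')) (a, b) (a', b')

lemma block_sum {ι : Type} (s : Finset ι)
    (X : ι → Matrix ((A × C) × (B × D)) ((A × C) × (B × D)) ℂ) (p q : C × D) :
    block (∑ i ∈ s, X i) p q = ∑ i ∈ s, block (X i) p q := by
  ext x y
  simp only [block, Matrix.submatrix_apply, Matrix.sum_apply]

lemma block_withIdle (Λ : Matrix (A × B) (A × B) ℂ → Matrix (A' × B') (A' × B') ℂ)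
    (X : Matrix ((A × E) × (B × F)) ((A × E) × (B × F)) ℂ) (p q : E × F) :
    block (withIdle E F Λ X) p q = Λ (block X p q) :=
  rfl

lemma block_withCatalyst (ρ : Matrix (A × B) (A × B) ℂ) (τ : Matrix (C × D) (C × D) ℂ)
    (p q : C × D) : block (withCatalyst ρ τ) p q = τ p q • ρ :=
  Matrix.ext fun _ _ => mul_comm _ _

lemma block_conj_alice [Fintype A] [Fintype B] [DecidableEq B] [Fintype E] [DecidableEq E]
    [Fintype F] [DecidableEq F] (K : Matrix A' A ℂ)
    (X : Matrix ((A × E) × (B × F)) ((A × E) × (B × F)) ℂ) (p q : E × F) :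
    block (((K ⊗ₖ (1 : Matrix E E ℂ)) ⊗ₖ (1 : Matrix (B × F) (B × F) ℂ)) * X *
      ((K ⊗ₖ (1 : Matrix E E ℂ)) ⊗ₖ (1 : Matrix (B × F) (B × F) ℂ))ᴴ) p q =
    (K ⊗ₖ (1 : Matrix B B ℂ)) * block X p q * (K ⊗ₖ (1 : Matrix B B ℂ))ᴴ := by
  ext ⟨a, b⟩ ⟨a', b'⟩
  simp [block, Matrix.mul_apply, Fintype.sum_prod_type, Matrix.one_apply, Prod.ext_iff,
    ite_and, Finset.sum_ite_eq, apply_ite]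

lemma block_conj_bob [Fintype A] [DecidableEq A] [Fintype B] [Fintype E] [DecidableEq E]
    [Fintype F] [DecidableEq F] (K : Matrix B' B ℂ)
    (X : Matrix ((A × E) × (B × F)) ((A × E) × (B × F)) ℂ) (p q : E × F) :
    block (((1 : Matrix (A × E) (A × E) ℂ) ⊗ₖ (K ⊗ₖ (1 : Matrix F F ℂ))) * X *
      ((1 : Matrix (A × E) (A × E) ℂ) ⊗ₖ (K ⊗ₖ (1 : Matrix F F ℂ)))ᴴ) p q =
    ((1 : Matrix A A ℂ) ⊗ₖ K) * block X p q * ((1 : Matrix A A ℂ) ⊗ₖ K)ᴴ := by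
  ext ⟨a, b⟩ ⟨a', b'⟩
  simp [block, Matrix.mul_apply, Fintype.sum_prod_type, Matrix.one_apply, Prod.ext_iff,
    ite_and, Finset.sum_ite_eq, apply_ite]

lemma systemPart_eq_sum_block [Fintype C] [Fintype D]
    (μ : Matrix ((A × C) × (B × D)) ((A × C) × (B × D)) ℂ) :
    systemPart μ = ∑ p, block μ p p := by
  ext x y
  simp only [systemPart, block, Matrix.sum_apply, Matrix.submatrix_apply, Fintype.sum_prod_type]

lemma catalystPart_eq_trace_block [Fintype A] [Fintype B]
    (μ : Matrix ((A × C) × (B × D)) ((A × C) × (B × D)) ℂ) (p q : C × D) :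
    catalystPart μ p q = (block μ p q).trace := by
  simp only [catalystPart, block, Matrix.trace, Matrix.diag_apply, Matrix.submatrix_apply,
    Fintype.sum_prod_type]

lemma systemPart_swapParts [Fintype A] [Fintype B]
    (X : Matrix ((A × C) × (B × D)) ((A × C) × (B × D)) ℂ) :
    systemPart (swapParts X) = catalystPart X :=
  rfl

lemma swapParts_withCatalyst (ρ : Matrix (A × B) (A × B) ℂ) (τ : Matrix (C × D) (C × D) ℂ) :
    swapParts (withCatalyst ρ τ) = withCatalyst τ ρ :=
  Matrix.ext fun _ _ => mul_comm _ _

lemma withCatalyst_eq_submatrix (ρ : Matrix (A × B) (A × B) ℂ) (τ : Matrix (C × D) (C × D) ℂ) :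
    withCatalyst ρ τ = (ρ ⊗ₖ τ).submatrix (Equiv.prodProdProdComm A C B D)
      (Equiv.prodProdProdComm A C B D) :=
  rfl

lemma isHermitian_withCatalyst {ρ : Matrix (A × B) (A × B) ℂ} {τ : Matrix (C × D) (C × D) ℂ}
    (hρ : ρ.IsHermitian) (hτ : τ.IsHermitian) : (withCatalyst ρ τ).IsHermitian := by
  rw [withCatalyst_eq_submatrix]
  refine Matrix.IsHermitian.submatrix ?_ _
  rw [Matrix.IsHermitian, Matrix.conjTranspose_kronecker, hρ.eq, hτ.eq]

lemma isLinearMap_withCatalyst (τ : Matrix (C × D) (C × D) ℂ) :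
    IsLinearMap ℂ fun ρ : Matrix (A × B) (A × B) ℂ => withCatalyst ρ τ :=
  ⟨fun _ _ => Matrix.ext fun _ _ => add_mul _ _ _, fun _ _ => Matrix.ext fun _ _ => mul_assoc _ _ _⟩

lemma posSemidef_withCatalyst [Finite A] [Finite B] [Finite C] [Finite D]
    {ρ : Matrix (A × B) (A × B) ℂ} {τ : Matrix (C × D) (C × D) ℂ} (hρ : ρ.PosSemidef)
    (hτ : τ.PosSemidef) : (withCatalyst ρ τ).PosSemidef := by
  rw [withCatalyst_eq_submatrix]
  exact (hρ.kronecker hτ).submatrix _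

lemma systemPart_withCatalyst [Fintype C] [Fintype D] (ρ : Matrix (A × B) (A × B) ℂ)
    {τ : Matrix (C × D) (C × D) ℂ} (hτ : τ.trace = 1) : systemPart (withCatalyst ρ τ) = ρ := by
  simp only [systemPart_eq_sum_block, block_withCatalyst, ← Finset.sum_smul]
  rw [show ∑ p, τ p p = 1 from hτ, one_smul]

lemma catalystPart_withCatalyst [Fintype A] [Fintype B] {ρ : Matrix (A × B) (A × B) ℂ}
    (hρ : ρ.trace = 1) (τ : Matrix (C × D) (C × D) ℂ) : catalystPart (withCatalyst ρ τ) = τ := by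
  rw [← systemPart_swapParts, swapParts_withCatalyst, systemPart_withCatalyst _ hρ]

variable [Fintype A] [Fintype B] [Fintype C] [Fintype D]

lemma trace_withCatalyst (ρ : Matrix (A × B) (A × B) ℂ) (τ : Matrix (C × D) (C × D) ℂ) :
    (withCatalyst ρ τ).trace = ρ.trace * τ.trace :=
  (Equiv.sum_comp (Equiv.prodProdProdComm A C B D) fun z => (ρ ⊗ₖ τ) z z).trans
    (Matrix.trace_kronecker ρ τ)

lemma IsState.withCatalyst {ρ : Matrix (A × B) (A × B) ℂ} {τ : Matrix (C × D) (C × D) ℂ}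
    (hρ : IsState ρ) (hτ : IsState τ) : IsState (withCatalyst ρ τ) :=
  ⟨posSemidef_withCatalyst hρ.1 hτ.1, by rw [trace_withCatalyst, hρ.2, hτ.2, mul_one]⟩

lemma traceNorm_withCatalyst_le [DecidableEq A] [DecidableEq B] [DecidableEq C] [DecidableEq D]
    {M : Matrix (A × B) (A × B) ℂ} (hM : M.IsHermitian) {τ : Matrix (C × D) (C × D) ℂ}
    (hτ : IsState τ) : traceNorm (withCatalyst M τ) ≤ traceNorm M :=
  traceNorm_map_le (isLinearMap_withCatalyst τ) (fun _ hX => posSemidef_withCatalyst hX hτ.1)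
    (fun X => by rw [trace_withCatalyst, hτ.2, mul_one]) hM

end Blocks

section Kraus

variable {A B ι : Type} [Fintype ι] {E : ι → Type} [∀ i, Fintype (E i)]

lemma trace_sum_kraus [Fintype A] [DecidableEq A] (K : ∀ i, Matrix (E i) A ℂ)
    (hK : ∑ i, (K i)ᴴ * K i = 1) (X : Matrix A A ℂ) :
    (∑ i, (K i * X * (K i)ᴴ).trace) = X.trace := by
  calc ∑ i, (K i * X * (K i)ᴴ).trace
      = ∑ i, ((K i)ᴴ * K i * X).trace :=
        Finset.sum_congr rfl fun i _ => by rw [Matrix.trace_mul_comm, Matrix.mul_assoc]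
    _ = X.trace := by rw [← Matrix.trace_sum, ← Finset.sum_mul, hK, Matrix.one_mul]

variable [DecidableEq A] [DecidableEq B]

lemma sum_kronecker_one_eq_one [Fintype B] (K : ∀ i, Matrix (E i) A ℂ)
    (hK : ∑ i, (K i)ᴴ * K i = 1) :
    ∑ i, (K i ⊗ₖ (1 : Matrix B B ℂ))ᴴ * (K i ⊗ₖ (1 : Matrix B B ℂ)) = 1 := by
  simp only [Matrix.conjTranspose_kronecker, ← Matrix.mul_kronecker_mul, Matrix.conjTranspose_one,
    Matrix.one_mul]
  rw [← Matrix.one_kronecker_one, ← hK]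
  ext x y
  simp only [Matrix.sum_apply, Matrix.kroneckerMap_apply, Finset.sum_mul]

lemma sum_one_kronecker_eq_one [Fintype A] (K : ∀ i, Matrix (E i) B ℂ)
    (hK : ∑ i, (K i)ᴴ * K i = 1) :
    ∑ i, ((1 : Matrix A A ℂ) ⊗ₖ K i)ᴴ * ((1 : Matrix A A ℂ) ⊗ₖ K i) = 1 := by
  simp only [Matrix.conjTranspose_kronecker, ← Matrix.mul_kronecker_mul, Matrix.conjTranspose_one,
    Matrix.one_mul]
  rw [← Matrix.one_kronecker_one, ← hK]
  ext x y
  simp only [Matrix.sum_apply, Matrix.kroneckerMap_apply, Finset.mul_sum]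

end Kraus

section Selector

variable {I J I' J' : Type}

/-- The matrix sending the basis vector labelled `k j` to the one labelled `j`, for injective `k`,
and the basis vectors outside the range of `k` to zero. -/
def selector [DecidableEq I] (k : J → I) : Matrix J I ℂ :=
  (1 : Matrix I I ℂ).submatrix k id

lemma selector_conj [Fintype I] [DecidableEq I] (k : J → I) (X : Matrix I I ℂ) :
    selector k * X * (selector k)ᴴ = X.submatrix k k := by
  ext x y
  simp [selector, Matrix.mul_apply, Matrix.one_apply]

lemma selector_kronecker [DecidableEq I] [DecidableEq I'] (k : J → I) (l : J' → I') :
    selector k ⊗ₖ selector l = selector (Prod.map k l) := by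
  simp only [selector, ← Matrix.one_kronecker_one]
  rfl

lemma selector_mul_conjTranspose [Fintype I] [DecidableEq I] [DecidableEq J] {k : J → I}
    (hk : k.Injective) : selector k * (selector k)ᴴ = 1 := by
  rw [← Matrix.submatrix_one (α := ℂ) k hk, ← selector_conj, Matrix.mul_one]

lemma selector_equiv_conjTranspose_mul_self [Fintype J] [DecidableEq I] (e : J ≃ I) :
    (selector e)ᴴ * selector e = 1 := by
  classical
  have : Fintype I := Fintype.ofEquiv J e
  simp only [selector, Matrix.conjTranspose_submatrix, Matrix.conjTranspose_one]
  rw [Matrix.submatrix_mul_equiv, Matrix.one_mul, Matrix.submatrix_id_id]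

lemma sum_selector_prodMk_conjTranspose_mul_self [Fintype I] [DecidableEq I] [Fintype J]
    [DecidableEq J] :
    ∑ j : J, (selector fun i : I => (i, j))ᴴ * selector (fun i : I => (i, j)) = 1 := by
  ext ⟨x, x'⟩ ⟨y, y'⟩
  simp [selector, Matrix.mul_apply, Matrix.one_apply, Matrix.sum_apply, Prod.ext_iff, ite_and,
    eq_comm]

end Selector

section LOCC

variable {A B C D E F A' B' A₁ B₁ A₂ B₂ : Type}
  [Fintype A] [DecidableEq A] [Fintype B] [DecidableEq B]
  [Fintype A'] [DecidableEq A'] [Fintype B'] [DecidableEq B']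
  {Λ : Matrix (A × B) (A × B) ℂ → Matrix (A' × B') (A' × B') ℂ}

lemma IsLOCC.isLinearMap (h : IsLOCC Λ) : IsLinearMap ℂ Λ := by
  induction h with
  | done => exact IsLinearMap.mk (fun _ _ => rfl) fun _ _ => rfl
  | alice K _ Λ _ ih | bob K _ Λ _ ih =>
    constructor <;> intros <;>
      simp only [Matrix.mul_add, Matrix.add_mul, (ih _).map_add, Finset.sum_add_distrib,
        Matrix.mul_smul, Matrix.smul_mul, (ih _).map_smul, Finset.smul_sum]

lemma IsLOCC.map_sum (h : IsLOCC Λ) {ι : Type} (s : Finset ι) (X : ι → Matrix (A × B) (A × B) ℂ) :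
    Λ (∑ i ∈ s, X i) = ∑ i ∈ s, Λ (X i) :=
  _root_.map_sum (h.isLinearMap.mk' Λ) X s

lemma IsLOCC.posSemidef (h : IsLOCC Λ) {X : Matrix (A × B) (A × B) ℂ} (hX : X.PosSemidef) :
    (Λ X).PosSemidef := by
  induction h with
  | done => exact hX
  | alice K _ Λ _ ih | bob K _ Λ _ ih =>
    exact Matrix.posSemidef_sum _ fun i _ => ih i (hX.mul_mul_conjTranspose_same _)

lemma IsLOCC.trace_eq (h : IsLOCC Λ) (X : Matrix (A × B) (A × B) ℂ) : (Λ X).trace = X.trace := by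
  induction h with
  | done => rfl
  | alice K hK Λ _ ih =>
    simp only [Matrix.trace_sum, ih]
    exact trace_sum_kraus _ (sum_kronecker_one_eq_one K hK) X
  | bob K hK Λ _ ih =>
    simp only [Matrix.trace_sum, ih]
    exact trace_sum_kraus _ (sum_one_kronecker_eq_one K hK) X

lemma IsLOCC.isState (h : IsLOCC Λ) {X : Matrix (A × B) (A × B) ℂ} (hX : IsState X) :
    IsState (Λ X) :=
  ⟨h.posSemidef hX.1, (h.trace_eq X).trans hX.2⟩

lemma IsLOCC.traceNorm_le (h : IsLOCC Λ) {M : Matrix (A × B) (A × B) ℂ} (hM : M.IsHermitian) :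
    traceNorm (Λ M) ≤ traceNorm M :=
  traceNorm_map_le h.isLinearMap (fun _ => h.posSemidef) h.trace_eq hM

lemma IsLOCC.traceNorm_sub_le (h : IsLOCC Λ) {X Y : Matrix (A × B) (A × B) ℂ} (hX : X.IsHermitian)
    (hY : Y.IsHermitian) : traceNorm (Λ X - Λ Y) ≤ traceNorm (X - Y) := by
  rw [← h.isLinearMap.map_sub]
  exact h.traceNorm_le (hX.sub hY)

lemma IsLOCC.comp [Fintype A₂] [DecidableEq A₂] [Fintype B₂] [DecidableEq B₂] (h : IsLOCC Λ)
    {Λ₂ : Matrix (A' × B') (A' × B') ℂ → Matrix (A₂ × B₂) (A₂ × B₂) ℂ} (h₂ : IsLOCC Λ₂) :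
    IsLOCC fun X => Λ₂ (Λ X) := by
  induction h with
  | done => exact h₂
  | alice K hK Λ hΛ ih =>
    simp only [h₂.map_sum]
    exact alice K hK (fun i X => Λ₂ (Λ i X)) ih
  | bob K hK Λ hΛ ih =>
    simp only [h₂.map_sum]
    exact bob K hK (fun i X => Λ₂ (Λ i X)) ih

lemma IsLOCC.withIdle (h : IsLOCC Λ) (E F : Type) [Fintype E] [DecidableEq E] [Fintype F]
    [DecidableEq F] : IsLOCC (withIdle E F Λ) := by
  induction h with
  | done => exact done
  | alice K hK Λ _ ih =>
    convert alice (B := _ × F) (fun i => K i ⊗ₖ (1 : Matrix E E ℂ))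
      (sum_kronecker_one_eq_one K hK) (fun i => LOCCRates.withIdle E F (Λ i)) ih using 2
    refine ext_block fun p q => ?_
    simp only [block_sum, block_withIdle, block_conj_alice]
  | bob K hK Λ _ ih =>
    convert bob (A := _ × E) (fun i => K i ⊗ₖ (1 : Matrix F F ℂ))
      (sum_kronecker_one_eq_one K hK) (fun i => LOCCRates.withIdle E F (Λ i)) ih using 2
    refine ext_block fun p q => ?_
    simp only [block_sum, block_withIdle, block_conj_bob]

lemma IsLOCC.oneWay {ι κ : Type} [Fintype ι] [Fintype κ] (K : ι → Matrix A' A ℂ)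
    (L : ι → κ → Matrix B' B ℂ) (hK : ∑ i, (K i)ᴴ * K i = 1)
    (hL : ∀ i, ∑ l, (L i l)ᴴ * L i l = 1) :
    IsLOCC fun X : Matrix (A × B) (A × B) ℂ =>
      ∑ i, ∑ l, (K i ⊗ₖ L i l) * X * (K i ⊗ₖ L i l)ᴴ := by
  have hKL (i l) :
      K i ⊗ₖ L i l = ((1 : Matrix A' A' ℂ) ⊗ₖ L i l) * (K i ⊗ₖ (1 : Matrix B B ℂ)) := by
    rw [← Matrix.mul_kronecker_mul, Matrix.one_mul, Matrix.mul_one]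
  simpa only [hKL, Matrix.conjTranspose_mul, Matrix.mul_assoc] using
    alice (B := B) K hK _ fun i => bob (A := A') (L i) (hL i) _ fun _ => done

lemma IsLOCC.relabel (f : A ≃ A') (g : B ≃ B') : IsLOCC (relabel f g) := by
  have h := oneWay (fun _ : Unit => selector f.symm) (fun _ (_ : Unit) => selector g.symm)
    ((Fintype.sum_unique _).trans (selector_equiv_conjTranspose_mul_self f.symm))
    (fun _ => (Fintype.sum_unique _).trans (selector_equiv_conjTranspose_mul_self g.symm))
  simp only [selector_kronecker, selector_conj, Fintype.sum_unique] at h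
  exact h

variable [Fintype C] [DecidableEq C] [Fintype D] [DecidableEq D]

lemma IsLOCC.systemPart :
    IsLOCC (systemPart : Matrix ((A × C) × (B × D)) ((A × C) × (B × D)) ℂ → _) := by
  convert oneWay (fun c : C => selector fun a : A => (a, c))
    (fun _ (d : D) => selector fun b : B => (b, d)) sum_selector_prodMk_conjTranspose_mul_self
    fun _ => sum_selector_prodMk_conjTranspose_mul_self using 1
  ext X x y
  simp only [selector_kronecker, selector_conj, Matrix.sum_apply]
  rfl

lemma IsLOCC.swapParts :
    IsLOCC (swapParts : Matrix ((A × C) × (B × D)) ((A × C) × (B × D)) ℂ → _) :=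
  relabel _ _

lemma systemPart_withIdle [Fintype E] [Fintype F] (h : IsLOCC Λ)
    (X : Matrix ((A × E) × (B × F)) ((A × E) × (B × F)) ℂ) :
    systemPart (withIdle E F Λ X) = Λ (systemPart X) := by
  simp only [systemPart_eq_sum_block, block_withIdle, h.map_sum]

lemma catalystPart_withIdle (h : IsLOCC Λ)
    (X : Matrix ((A × E) × (B × F)) ((A × E) × (B × F)) ℂ) :
    catalystPart (withIdle E F Λ X) = catalystPart X := by
  ext x y
  simp only [catalystPart_eq_trace_block, block_withIdle, h.trace_eq]

lemma withIdle_withCatalyst (h : IsLOCC Λ) (ρ : Matrix (A × B) (A × B) ℂ)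
    (τ : Matrix (E × F) (E × F) ℂ) :
    withIdle E F Λ (withCatalyst ρ τ) = withCatalyst (Λ ρ) τ :=
  ext_block fun p q => by
    rw [block_withIdle, block_withCatalyst, block_withCatalyst, h.isLinearMap.map_smul]

lemma IsLOCC.exists_withCatalyst [Fintype A₁] [DecidableEq A₁] [Fintype B₁] [DecidableEq B₁]
    [Fintype A₂] [DecidableEq A₂] [Fintype B₂] [DecidableEq B₂]
    {Λ₁ : Matrix (A × B) (A × B) ℂ → Matrix (A₁ × B₁) (A₁ × B₁) ℂ}
    {Λ₂ : Matrix (C × D) (C × D) ℂ → Matrix (A₂ × B₂) (A₂ × B₂) ℂ}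
    (h₁ : IsLOCC Λ₁) (h₂ : IsLOCC Λ₂) :
    ∃ Λ : Matrix ((A × C) × (B × D)) ((A × C) × (B × D)) ℂ →
        Matrix ((A₁ × A₂) × (B₁ × B₂)) ((A₁ × A₂) × (B₁ × B₂)) ℂ,
      IsLOCC Λ ∧ ∀ ρ τ, Λ (withCatalyst ρ τ) = withCatalyst (Λ₁ ρ) (Λ₂ τ) :=
  ⟨_, (((h₁.withIdle C D).comp swapParts).comp (h₂.withIdle A₁ B₁)).comp swapParts, fun ρ τ => by
    rw [withIdle_withCatalyst h₁, swapParts_withCatalyst, withIdle_withCatalyst h₂,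
      swapParts_withCatalyst]⟩

lemma traceNorm_withCatalyst_sub_le {ρ ρ' : Matrix (A × B) (A × B) ℂ}
    {τ τ' : Matrix (C × D) (C × D) ℂ} (hρ : ρ.IsHermitian) (hρ' : IsState ρ') (hτ : IsState τ)
    (hτ' : τ'.IsHermitian) :
    traceNorm (withCatalyst ρ τ - withCatalyst ρ' τ') ≤
      traceNorm (ρ - ρ') + traceNorm (τ - τ') := by
  have hρρ' := hρ.sub hρ'.1.isHermitian
  have hττ' := hτ.1.isHermitian.sub hτ'
  have hττ'ρ' := isHermitian_withCatalyst hττ' hρ'.1.isHermitian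
  have htelescope : withCatalyst ρ τ - withCatalyst ρ' τ' =
      withCatalyst (ρ - ρ') τ + swapParts (withCatalyst (τ - τ') ρ') := by
    rw [swapParts_withCatalyst]
    ext x y
    simp only [withCatalyst, Matrix.sub_apply, Matrix.add_apply]
    ring
  rw [htelescope]
  calc traceNorm (withCatalyst (ρ - ρ') τ + swapParts (withCatalyst (τ - τ') ρ'))
      ≤ traceNorm (withCatalyst (ρ - ρ') τ) +
          traceNorm (swapParts (withCatalyst (τ - τ') ρ')) :=
        traceNorm_add_le (isHermitian_withCatalyst hρρ' hτ.1.isHermitian) (hττ'ρ'.submatrix _)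
    _ ≤ traceNorm (ρ - ρ') + traceNorm (τ - τ') :=
        add_le_add (traceNorm_withCatalyst_le hρρ' hτ)
          ((IsLOCC.swapParts.traceNorm_le hττ'ρ').trans (traceNorm_withCatalyst_le hττ' hρ'))

end LOCC

section Marginals

lemma update_funSplitAt_symm {ι T : Type} [DecidableEq ι] (i : ι) (t s : T)
    (c : {j // j ≠ i} → T) :
    Function.update ((Equiv.funSplitAt i T).symm (t, c)) i s =
      (Equiv.funSplitAt i T).symm (s, c) := by
  ext j
  by_cases hj : j = i
  · subst hj
    simp
  · simp [hj]

lemma update_appendEquiv_castAdd {T : Type} {m n : ℕ} (u : Fin m → T) (v : Fin n → T)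
    (i : Fin m) (s : T) :
    Function.update (Fin.appendEquiv m n (u, v)) (Fin.castAdd n i) s =
      Fin.appendEquiv m n (Function.update u i s, v) := by
  ext j
  cases j using Fin.addCases with
  | left j => simp [Fin.appendEquiv, Function.update_apply]
  | right j => simp [Fin.appendEquiv, Fin.ext_iff, (i.2.trans_le (Nat.le_add_right m j)).ne']

lemma update_appendEquiv_natAdd {T : Type} {m n : ℕ} (u : Fin m → T) (v : Fin n → T)
    (i : Fin n) (s : T) :
    Function.update (Fin.appendEquiv m n (u, v)) (Fin.natAdd m i) s =
      Fin.appendEquiv m n (u, Function.update v i s) := by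
  ext j
  cases j using Fin.addCases with
  | left j => simp [Fin.appendEquiv, Fin.ext_iff, (j.2.trans_le (Nat.le_add_right m i)).ne]
  | right j => simp [Fin.appendEquiv, Function.update_apply]

variable {A B : Type} [Fintype A] [DecidableEq A] [Fintype B] [DecidableEq B] {m n : ℕ}

lemma marginal_eq_systemPart
    (μ : Matrix ((Fin m → A) × (Fin m → B)) ((Fin m → A) × (Fin m → B)) ℂ) (i : Fin m) :
    marginal μ i = systemPart (relabel (Equiv.funSplitAt i A) (Equiv.funSplitAt i B) μ) := by
  ext x y
  have happly {T : Type} (t : T) (c : {j // j ≠ i} → T) :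
      (Equiv.funSplitAt i T).symm (t, c) i = t := by
    simp
  simp only [marginal, ← (Equiv.funSplitAt i A).symm.sum_comp,
    ← (Equiv.funSplitAt i B).symm.sum_comp, Fintype.sum_prod_type, update_funSplitAt_symm, happly,
    ite_and, Finset.sum_ite_irrel, Finset.sum_const_zero, Finset.sum_ite_eq', Finset.mem_univ,
    if_true]
  rfl

lemma IsLOCC.marginal (i : Fin m) :
    IsLOCC fun μ : Matrix ((Fin m → A) × (Fin m → B)) ((Fin m → A) × (Fin m → B)) ℂ =>
      marginal μ i := by
  simp only [marginal_eq_systemPart]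
  exact (relabel _ _).comp systemPart

variable (X : Matrix (((Fin m → A) × (Fin n → A)) × ((Fin m → B) × (Fin n → B)))
  (((Fin m → A) × (Fin n → A)) × ((Fin m → B) × (Fin n → B))) ℂ)

lemma marginal_relabel_append_castAdd (i : Fin m) :
    marginal (relabel (Fin.appendEquiv m n) (Fin.appendEquiv m n) X) (Fin.castAdd n i) =
      marginal (systemPart X) i := by
  ext x y
  have happly {T : Type} (u : Fin m → T) (v : Fin n → T) :
      Fin.appendEquiv m n (u, v) (Fin.castAdd n i) = u i :=
    Fin.append_left _ _ _
  simp only [marginal, ← (Fin.appendEquiv m n).sum_comp, Fintype.sum_prod_type,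
    update_appendEquiv_castAdd, happly, relabel_apply, systemPart]
  refine Finset.sum_congr rfl fun u _ => ?_
  rw [Finset.sum_comm]
  simp only [Finset.sum_ite_irrel, Finset.sum_const_zero]

lemma marginal_relabel_append_natAdd (i : Fin n) :
    marginal (relabel (Fin.appendEquiv m n) (Fin.appendEquiv m n) X) (Fin.natAdd m i) =
      marginal (catalystPart X) i := by
  ext x y
  have happly {T : Type} (u : Fin m → T) (v : Fin n → T) :
      Fin.appendEquiv m n (u, v) (Fin.natAdd m i) = v i :=
    Fin.append_right _ _ _
  simp only [marginal, ← (Fin.appendEquiv m n).sum_comp, Fintype.sum_prod_type_right,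
    update_appendEquiv_natAdd, happly, relabel_apply, catalystPart]
  refine Finset.sum_congr rfl fun v _ => ?_
  rw [Finset.sum_comm]
  simp only [Finset.sum_ite_irrel, Finset.sum_const_zero]

end Marginals

section Copies

variable {A B : Type}

lemma copies_add (ρ : Matrix (A × B) (A × B) ℂ) (m n : ℕ) :
    copies ρ (m + n) = relabel (Fin.appendEquiv m n) (Fin.appendEquiv m n)
      (withCatalyst (copies ρ m) (copies ρ n)) :=
  Matrix.ext fun _ _ => Fin.prod_univ_add _

lemma relabel_symm_copies_add (ρ : Matrix (A × B) (A × B) ℂ) (m n : ℕ) :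
    relabel (Fin.appendEquiv m n).symm (Fin.appendEquiv m n).symm (copies ρ (m + n)) =
      withCatalyst (copies ρ m) (copies ρ n) := by
  rw [copies_add, relabel_symm_relabel]

lemma copies_zero [DecidableEq A] [DecidableEq B] (ρ : Matrix (A × B) (A × B) ℂ) :
    copies ρ 0 = 1 := by
  ext x y
  rw [Subsingleton.elim x y, Matrix.one_apply_eq]
  exact Fin.prod_univ_zero _

lemma copies_one (ρ : Matrix (A × B) (A × B) ℂ) :
    copies ρ 1 = relabel (Equiv.funUnique (Fin 1) A).symm (Equiv.funUnique (Fin 1) B).symm ρ :=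
  Matrix.ext fun _ _ => Fin.prod_univ_one _

variable [Fintype A] [Fintype B] {ρ : Matrix (A × B) (A × B) ℂ}

lemma trace_copies (ρ : Matrix (A × B) (A × B) ℂ) (n : ℕ) :
    (copies ρ n).trace = ρ.trace ^ n := by
  classical
  induction n with
  | zero => simp [copies_zero]
  | succ n ih =>
    rw [copies_add, (IsLOCC.relabel _ _).trace_eq, trace_withCatalyst, ih, copies_one,
      (IsLOCC.relabel _ _).trace_eq, pow_succ]

lemma IsState.copies (hρ : IsState ρ) (n : ℕ) : IsState (copies ρ n) := by
  classical
  refine ⟨?_, by rw [trace_copies, hρ.2, one_pow]⟩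
  induction n with
  | zero => exact copies_zero ρ ▸ Matrix.PosSemidef.one
  | succ n ih =>
    rw [copies_add, copies_one]
    exact (IsLOCC.relabel _ _).posSemidef
      (posSemidef_withCatalyst ih ((IsLOCC.relabel _ _).posSemidef hρ.1))

variable [DecidableEq A] [DecidableEq B]

lemma marginal_relabel_funUnique_symm (ρ : Matrix (A × B) (A × B) ℂ) (i : Fin 1) :
    marginal (relabel (Equiv.funUnique (Fin 1) A).symm (Equiv.funUnique (Fin 1) B).symm ρ) i =
      ρ := by
  obtain rfl := Subsingleton.elim 0 i
  ext x y
  simp only [marginal, ← (Equiv.funUnique (Fin 1) A).symm.sum_comp,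
    ← (Equiv.funUnique (Fin 1) B).symm.sum_comp, ite_and]
  simp [relabel]

lemma marginal_copies (hρ : ρ.trace = 1) {m : ℕ} (i : Fin m) : marginal (copies ρ m) i = ρ := by
  have htrace (n : ℕ) : (LOCCRates.copies ρ n).trace = 1 := by rw [trace_copies, hρ, one_pow]
  induction m with
  | zero => exact i.elim0
  | succ m ih =>
    rw [copies_add]
    cases i using Fin.addCases with
    | left i => rw [marginal_relabel_append_castAdd, systemPart_withCatalyst _ (htrace 1), ih]
    | right i =>
      rw [marginal_relabel_append_natAdd, catalystPart_withCatalyst (htrace m), copies_one,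
        marginal_relabel_funUnique_symm]

end Copies

section Preparation

variable {A B C D C' D' : Type} [Fintype A] [DecidableEq A] [Fintype B] [DecidableEq B]
  [Fintype C] [DecidableEq C] [Fintype D] [DecidableEq D]
  [Fintype C'] [DecidableEq C'] [Fintype D'] [DecidableEq D']

/-- `τ` can be prepared by LOCC with arbitrary accuracy from finitely many copies of `ρ`; no rate
is required, so the number of copies may grow without bound as the accuracy improves. -/
def Preparable (ρ : Matrix (A × B) (A × B) ℂ) (τ : Matrix (C × D) (C × D) ℂ) : Prop :=
  ∀ ε : ℝ, 0 < ε → ∃ n : ℕ,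
    ∃ Λ : Matrix ((Fin n → A) × (Fin n → B)) ((Fin n → A) × (Fin n → B)) ℂ →
      Matrix (C × D) (C × D) ℂ, IsLOCC Λ ∧ traceNorm (Λ (copies ρ n) - τ) < ε

variable {ρ : Matrix (A × B) (A × B) ℂ} {τ : Matrix (C × D) (C × D) ℂ}
  {τ' : Matrix (C' × D') (C' × D') ℂ}

lemma Preparable.map (h : Preparable ρ τ) (hρ : IsState ρ) (hτ : τ.IsHermitian)
    {Λ : Matrix (C × D) (C × D) ℂ → Matrix (C' × D') (C' × D') ℂ} (hΛ : IsLOCC Λ) :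
    Preparable ρ (Λ τ) := by
  intro ε hε
  obtain ⟨n, Φ, hΦ, hΦτ⟩ := h ε hε
  exact ⟨n, _, hΦ.comp hΛ,
    (hΛ.traceNorm_sub_le (hΦ.isState (hρ.copies n)).1.isHermitian hτ).trans_lt hΦτ⟩

lemma Preparable.withCatalyst (h : Preparable ρ τ) (h' : Preparable ρ τ') (hρ : IsState ρ)
    (hτ : IsState τ) (hτ' : τ'.IsHermitian) : Preparable ρ (withCatalyst τ τ') := by
  intro ε hε
  obtain ⟨n, Φ, hΦ, hΦτ⟩ := h (ε / 2) (half_pos hε)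
  obtain ⟨n', Φ', hΦ', hΦτ'⟩ := h' (ε / 2) (half_pos hε)
  obtain ⟨Λ, hΛ, hΛ_eq⟩ := hΦ.exists_withCatalyst hΦ'
  refine ⟨n + n', _, (IsLOCC.relabel (Fin.appendEquiv n n').symm (Fin.appendEquiv n n').symm).comp
    hΛ, ?_⟩
  rw [relabel_symm_copies_add, hΛ_eq]
  exact (traceNorm_withCatalyst_sub_le (hΦ.isState (hρ.copies n)).1.isHermitian hτ
    (hΦ'.isState (hρ.copies n')) hτ').trans_lt (by linarith)

lemma Preparable.copies (h : Preparable ρ τ) (hρ : IsState ρ) (hτ : IsState τ) (k : ℕ) :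
    Preparable ρ (copies τ k) := by
  induction k with
  | zero =>
    refine fun ε hε => ⟨0, _, IsLOCC.relabel (Equiv.ofUnique _ _) (Equiv.ofUnique _ _), ?_⟩
    rwa [copies_zero, copies_zero, relabel, Matrix.reindex_apply, Matrix.submatrix_one_equiv,
      sub_self, traceNorm_zero]
  | succ k ih =>
    rw [copies_add, copies_one]
    have hτ₁ := (IsLOCC.relabel (Equiv.funUnique (Fin 1) C).symm
      (Equiv.funUnique (Fin 1) D).symm).isState hτ
    exact (ih.withCatalyst (h.map hρ hτ.1.isHermitian (IsLOCC.relabel _ _)) hρ (hτ.copies k)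
      hτ₁.1.isHermitian).map hρ ((hτ.copies k).withCatalyst hτ₁).1.isHermitian (IsLOCC.relabel _ _)

lemma preparable_of_achievable (hρ : IsState ρ) (hτ : IsState τ) {r : ℝ} (hr : 0 < r)
    (h : Achievable ρ τ r) : Preparable ρ τ := by
  intro ε hε
  obtain ⟨m, n, -, Λ, hΛ, hΛε, hrm⟩ := h ε hε r hr
  have hm : 0 < m := by
    rcases Nat.eq_zero_or_pos m with rfl | hm
    · simp at hrm
    · exact hm
  refine ⟨n, _, hΛ.comp (IsLOCC.marginal ⟨0, hm⟩), ?_⟩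
  rw [← marginal_copies hτ.2 (⟨0, hm⟩ : Fin m)]
  exact ((IsLOCC.marginal _).traceNorm_sub_le (hΛ.isState (hρ.copies n)).1.isHermitian
    (hτ.copies m).1.isHermitian).trans_lt hΛε

end Preparation

section PureStates

variable {C D C' D' : Type}

/-- The operator `v vᴴ` of the vector `v` whose amplitudes are the entries of the matrix `V`. Local
operators then act on `V` by multiplication from the two sides. -/
def pureState (V : Matrix C D ℂ) : Matrix (C × D) (C × D) ℂ :=
  Matrix.vecMulVec (fun p => V p.1 p.2) (star fun p => V p.1 p.2)

lemma pureState_smul (c : ℂ) (V : Matrix C D ℂ) :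
    pureState (c • V) = (c * star c) • pureState V := by
  ext p q
  simp only [pureState, Matrix.vecMulVec_apply, Pi.star_apply, Matrix.smul_apply, smul_eq_mul,
    star_mul']
  ring

lemma copies_pureState (V : Matrix C D ℂ) (k : ℕ) :
    copies (pureState V) k =
      pureState (fun (x : Fin k → C) (y : Fin k → D) => ∏ i, V (x i) (y i)) := by
  ext x y
  simp only [copies, pureState, Matrix.vecMulVec_apply, Pi.star_apply, Finset.prod_mul_distrib,
    star_prod]

lemma posSemidef_pureState [Finite C] [Finite D] (V : Matrix C D ℂ) : (pureState V).PosSemidef :=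
  Matrix.posSemidef_vecMulVec_self_star _

variable [Fintype C] [Fintype D]

lemma trace_pureState (V : Matrix C D ℂ) : (pureState V).trace = (V * Vᴴ).trace := by
  simp only [pureState, Matrix.trace, Matrix.diag_apply, Matrix.vecMulVec_apply, Pi.star_apply,
    Fintype.sum_prod_type, Matrix.mul_apply, Matrix.conjTranspose_apply]

lemma kronecker_conj_pureState (M : Matrix C' C ℂ) (N : Matrix D' D ℂ) (V : Matrix C D ℂ) :
    (M ⊗ₖ N) * pureState V * (M ⊗ₖ N)ᴴ = pureState (M * V * Nᵀ) := by
  have hvec : (M ⊗ₖ N) *ᵥ (fun p => V p.1 p.2) = fun p => (M * V * Nᵀ) p.1 p.2 := by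
    ext ⟨x, y⟩
    simp only [Matrix.mulVec, dotProduct, Matrix.mul_apply, Fintype.sum_prod_type,
      Matrix.kroneckerMap_apply, Matrix.transpose_apply, Finset.sum_mul]
    rw [Finset.sum_comm]
    exact Finset.sum_congr rfl fun _ _ => Finset.sum_congr rfl fun _ _ => by ring
  rw [pureState, pureState, Matrix.mul_vecMulVec, Matrix.vecMulVec_mul, ← hvec, Matrix.star_mulVec]

open scoped MatrixOrder Matrix.Norms.L2Operator in
lemma exists_sum_pureState_eq {τ : Matrix (C × D) (C × D) ℂ} (hτ : τ.PosSemidef) :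
    ∃ V : C × D → Matrix C D ℂ, ∑ j, pureState (V j) = τ := by
  classical
  obtain ⟨B, rfl⟩ := CStarAlgebra.nonneg_iff_eq_star_mul_self.1 hτ.nonneg
  refine ⟨fun j c d => star (B j (c, d)), ?_⟩
  ext p q
  simp only [pureState, Matrix.sum_apply, Matrix.vecMulVec_apply, Pi.star_apply, star_star,
    Matrix.star_eq_conjTranspose, Matrix.mul_apply, Matrix.conjTranspose_apply]

end PureStates

section MaximallyEntangled

variable {X : Type} [Fintype X] [DecidableEq X] {W : Matrix X X ℂ}

/-- The bipartite pure state with amplitude matrix `W` is maximally entangled: its reduced state is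
maximally mixed. -/
def IsMaximallyEntangled (W : Matrix X X ℂ) : Prop :=
  W * Wᴴ = (Fintype.card X : ℂ)⁻¹ • 1

lemma IsMaximallyEntangled.isState [Nonempty X] (hW : IsMaximallyEntangled W) :
    IsState (pureState W) := by
  refine ⟨posSemidef_pureState W, ?_⟩
  rw [trace_pureState, hW, Matrix.trace_smul, Matrix.trace_one, smul_eq_mul,
    inv_mul_cancel₀ (Nat.cast_ne_zero.2 Fintype.card_ne_zero)]

lemma IsMaximallyEntangled.conjTranspose_mul_self [Nonempty X] (hW : IsMaximallyEntangled W) :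
    Wᴴ * W = (Fintype.card X : ℂ)⁻¹ • 1 := by
  have hcard : (Fintype.card X : ℂ) ≠ 0 := Nat.cast_ne_zero.2 Fintype.card_ne_zero
  have hinv : W * ((Fintype.card X : ℂ) • Wᴴ) = 1 := by
    rw [Matrix.mul_smul, hW, smul_inv_smul₀ hcard]
  rwa [mul_eq_one_comm, Matrix.smul_mul, ← eq_inv_smul_iff₀ hcard] at hinv

lemma IsMaximallyEntangled.pi (hW : IsMaximallyEntangled W) (k : ℕ) :
    IsMaximallyEntangled fun x y : Fin k → X => ∏ i, W (x i) (y i) := by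
  ext x y
  have hentry (i : Fin k) : ∑ z, W (x i) z * star (W (y i) z) =
      (Fintype.card X : ℂ)⁻¹ * (1 : Matrix X X ℂ) (x i) (y i) :=
    congrFun₂ hW (x i) (y i)
  calc ∑ z : Fin k → X, (∏ i, W (x i) (z i)) * star (∏ i, W (y i) (z i))
      = ∏ i, ∑ z, W (x i) z * star (W (y i) z) := by
        simp only [star_prod, ← Finset.prod_mul_distrib, Finset.prod_univ_sum,
          Fintype.piFinset_univ]
    _ = (Fintype.card (Fin k → X) : ℂ)⁻¹ * (1 : Matrix (Fin k → X) (Fin k → X) ℂ) x y := by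
        simp only [hentry, Finset.prod_mul_distrib]
        simp [Matrix.one_apply, Finset.prod_ite_zero, funext_iff]

lemma isMaximallyEntangled_singlet :
    IsMaximallyEntangled (Matrix.of (Function.curry singletVec)) := by
  have hsqrt : ((Real.sqrt 2 : ℝ) : ℂ)⁻¹ * ((Real.sqrt 2 : ℝ) : ℂ)⁻¹ = 2⁻¹ := by
    rw [← mul_inv, ← Complex.ofReal_mul, Real.mul_self_sqrt zero_le_two, Complex.ofReal_ofNat]
  ext x y
  fin_cases x <;> fin_cases y <;>
    simp [Matrix.mul_apply, singletVec, hsqrt, Complex.conj_ofReal]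

end MaximallyEntangled

section Weyl

variable {X : Type} [AddCommGroup X] [Fintype X] [DecidableEq X]

/-- The Heisenberg–Weyl operators of a finite abelian group, composed of a translation and a
multiplication by a character. -/
def weyl (u : X × AddChar X ℂ) : Matrix X X ℂ :=
  fun x y => if x = y + u.1 then u.2 y else 0

lemma weyl_mul_conjTranspose (u : X × AddChar X ℂ) : weyl u * (weyl u)ᴴ = 1 := by
  ext x z
  rw [Matrix.mul_apply]
  simp only [weyl, ← sub_eq_iff_eq_add, Matrix.conjTranspose_apply, ite_mul, zero_mul,
    Finset.sum_ite_eq, Finset.mem_univ, if_true]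
  rcases eq_or_ne x z with rfl | hxz
  · simp [Complex.mul_conj, Complex.normSq_eq_norm_sq]
  · simp [hxz, hxz.symm]

lemma sum_weyl_twirl (Y : Matrix X X ℂ) :
    ∑ u, (weyl u)ᴴ * Y * weyl u = ((Fintype.card X : ℂ) * Y.trace) • 1 := by
  ext a b
  have hentry (u : X × AddChar X ℂ) : ((weyl u)ᴴ * Y * weyl u) a b =
      u.2 (b - a) * Y (a + u.1) (b + u.1) := by
    simp only [Matrix.mul_apply, weyl, Matrix.conjTranspose_apply, apply_ite, star_zero,
      ite_mul, zero_mul, mul_zero, Finset.sum_ite_eq', Finset.mem_univ, if_true]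
    rw [sub_eq_add_neg, AddChar.map_add_eq_mul, AddChar.map_neg_eq_conj, starRingEnd_apply]
    ring
  simp only [Matrix.sum_apply, hentry, Fintype.sum_prod_type, ← Finset.sum_mul,
    AddChar.sum_apply_eq_ite, sub_eq_zero]
  rcases eq_or_ne a b with rfl | hab
  · simp only [if_true, ← Finset.mul_sum, Matrix.smul_apply, Matrix.one_apply_eq, smul_eq_mul,
      mul_one]
    exact congrArg _ (Equiv.sum_comp (Equiv.addLeft a) fun z => Y z z)
  · simp [hab, hab.symm]

end Weyl

section Preparation

lemma IsState.conj_isometry {X Y : Type} [Fintype X] [DecidableEq X] [Fintype Y]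
    {ρ : Matrix X X ℂ} (hρ : IsState ρ) {J : Matrix Y X ℂ} (hJ : Jᴴ * J = 1) :
    IsState (J * ρ * Jᴴ) := by
  refine ⟨hρ.1.mul_mul_conjTranspose_same J, ?_⟩
  rw [Matrix.trace_mul_comm, ← Matrix.mul_assoc, hJ, Matrix.one_mul, hρ.2]

lemma IsMaximallyEntangled.sum_conjTranspose_mul_self_eq_one {C J X : Type} [Fintype C]
    [Fintype J] [AddCommGroup X] [Fintype X] [DecidableEq X] {W : Matrix X X ℂ}
    (hW : IsMaximallyEntangled W) {V : J → Matrix C X ℂ} (hV : ∑ j, ((V j)ᴴ * V j).trace = 1) :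
    ∑ i : J × (X × AddChar X ℂ), (V i.1 * weyl i.2 * Wᴴ)ᴴ * (V i.1 * weyl i.2 * Wᴴ) = 1 := by
  have hcard : (Fintype.card X : ℂ) ≠ 0 := Nat.cast_ne_zero.2 Fintype.card_ne_zero
  calc ∑ i : J × (X × AddChar X ℂ), (V i.1 * weyl i.2 * Wᴴ)ᴴ * (V i.1 * weyl i.2 * Wᴴ)
      = ∑ j, W * (∑ u, (weyl u)ᴴ * ((V j)ᴴ * V j) * weyl u) * Wᴴ := by
        simp only [Fintype.sum_prod_type (α₁ := J), Matrix.conjTranspose_mul,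
          Matrix.conjTranspose_conjTranspose, Matrix.mul_assoc, Finset.mul_sum, Finset.sum_mul]
    _ = ∑ j, ((V j)ᴴ * V j).trace • (1 : Matrix X X ℂ) := by
        refine Finset.sum_congr rfl fun j _ => ?_
        rw [sum_weyl_twirl, Matrix.mul_smul, Matrix.smul_mul, Matrix.mul_one, hW, smul_smul,
          mul_right_comm, mul_inv_cancel₀ hcard, one_mul]
    _ = 1 := by rw [← Finset.sum_smul, hV, one_smul]

variable {A B C D X Y : Type} [Fintype A] [DecidableEq A] [Fintype B] [DecidableEq B]
  [Fintype C] [DecidableEq C] [Fintype D] [DecidableEq D] [Fintype Y] [DecidableEq Y]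

/- Writing `τ = ∑ j, |V j⟩⟨V j|`, the outcomes `(j, u)` of Alice's measurement leave Bob with the
state `V j` up to the unitary `weyl u`, which he undoes. -/
lemma IsMaximallyEntangled.exists_isLOCC_eq [AddCommGroup X] [Fintype X] [DecidableEq X]
    {W : Matrix X X ℂ} (hW : IsMaximallyEntangled W) {τ : Matrix (C × X) (C × X) ℂ}
    (hτ : IsState τ) :
    ∃ Λ : Matrix (X × X) (X × X) ℂ → Matrix (C × X) (C × X) ℂ,
      IsLOCC Λ ∧ Λ (pureState W) = τ := by
  have hcard : (Fintype.card X : ℂ) ≠ 0 := Nat.cast_ne_zero.2 Fintype.card_ne_zero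
  obtain ⟨V, hV⟩ := exists_sum_pureState_eq hτ.1
  let K (i : (C × X) × (X × AddChar X ℂ)) : Matrix C X ℂ := V i.1 * weyl i.2 * Wᴴ
  let L (i : (C × X) × (X × AddChar X ℂ)) (_ : Unit) : Matrix X X ℂ := ((weyl i.2)ᴴ)ᵀ
  have htrace : ∑ j, ((V j)ᴴ * V j).trace = 1 := by
    rw [← hτ.2, ← hV, Matrix.trace_sum]
    exact Finset.sum_congr rfl fun j _ => by rw [trace_pureState, Matrix.trace_mul_comm]
  have hL (i) : ∑ l, (L i l)ᴴ * L i l = 1 := by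
    have hL_conj : (((weyl i.2)ᴴ)ᵀ)ᴴ = (weyl i.2)ᵀ := by ext; simp
    rw [Fintype.sum_unique, hL_conj, ← Matrix.transpose_mul,
      mul_eq_one_comm.1 (weyl_mul_conjTranspose i.2), Matrix.transpose_one]
  have hKL (i l) : K i * W * (L i l)ᵀ = (Fintype.card X : ℂ)⁻¹ • V i.1 := by
    calc V i.1 * weyl i.2 * Wᴴ * W * (weyl i.2)ᴴ
        = V i.1 * weyl i.2 * (Wᴴ * W) * (weyl i.2)ᴴ := by rw [Matrix.mul_assoc _ Wᴴ]
      _ = (Fintype.card X : ℂ)⁻¹ • (V i.1 * (weyl i.2 * (weyl i.2)ᴴ)) := by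
          rw [hW.conjTranspose_mul_self, Matrix.mul_smul, Matrix.mul_one, Matrix.smul_mul,
            Matrix.mul_assoc]
      _ = (Fintype.card X : ℂ)⁻¹ • V i.1 := by rw [weyl_mul_conjTranspose, Matrix.mul_one]
  refine ⟨_, IsLOCC.oneWay K L (hW.sum_conjTranspose_mul_self_eq_one htrace) hL, ?_⟩
  simp only [kronecker_conj_pureState, hKL, pureState_smul, Fintype.sum_unique,
    Fintype.sum_prod_type_right (α₁ := C × X), ← Finset.smul_sum, hV]
  rw [Finset.sum_const, Finset.card_univ, Fintype.card_prod, AddChar.card_eq,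
    ← Nat.cast_smul_eq_nsmul ℂ, smul_smul]
  convert one_smul ℂ τ
  push_cast
  rw [star_inv₀, star_natCast]
  field_simp

lemma sum_single_conjTranspose_mul_self (d : D) :
    ∑ y : Y, (Matrix.single d y (1 : ℂ))ᴴ * Matrix.single d y (1 : ℂ) = 1 := by
  simp [Matrix.conjTranspose_single, Matrix.sum_single_one]

lemma exists_isLOCC_conj_isometry_eq [Nonempty D] {J : Matrix Y D ℂ} (hJ : Jᴴ * J = 1) :
    ∃ Λ : Matrix (C × Y) (C × Y) ℂ → Matrix (C × D) (C × D) ℂ, IsLOCC Λ ∧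
      ∀ X, Λ (((1 : Matrix C C ℂ) ⊗ₖ J) * X * ((1 : Matrix C C ℂ) ⊗ₖ J)ᴴ) = X := by
  obtain ⟨d⟩ := ‹Nonempty D›
  let P : Matrix Y Y ℂ := 1 - J * Jᴴ
  let K : Option Y → Matrix D Y ℂ := fun l => l.elim Jᴴ fun y => Matrix.single d y (1 : ℂ) * P
  have hPJ : P * J = 0 := by
    rw [Matrix.sub_mul, Matrix.one_mul, Matrix.mul_assoc, hJ, Matrix.mul_one, sub_self]
  have hP : Pᴴ * P = P := by
    have hherm : Pᴴ = P := by
      simp only [P, Matrix.conjTranspose_sub, Matrix.conjTranspose_one, Matrix.conjTranspose_mul,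
        Matrix.conjTranspose_conjTranspose]
    calc Pᴴ * P = P * 1 - P * J * Jᴴ := by rw [hherm, Matrix.mul_assoc, ← Matrix.mul_sub]
      _ = P := by rw [hPJ, Matrix.zero_mul, sub_zero, Matrix.mul_one]
  have hK : ∑ l, (K l)ᴴ * K l = 1 := by
    calc ∑ l, (K l)ᴴ * K l
        = J * Jᴴ + Pᴴ * (∑ y : Y, (Matrix.single d y (1 : ℂ))ᴴ * Matrix.single d y (1 : ℂ)) *
            P := by
          simp only [K, Fintype.sum_option, Option.elim, Matrix.conjTranspose_conjTranspose,
            Matrix.conjTranspose_mul, Finset.mul_sum, Finset.sum_mul, Matrix.mul_assoc]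
      _ = 1 := by
          rw [sum_single_conjTranspose_mul_self, Matrix.mul_one, hP, add_sub_cancel]
  refine ⟨_, IsLOCC.bob K hK _ fun _ => IsLOCC.done, fun X => ?_⟩
  have hKJ (l) : ((1 : Matrix C C ℂ) ⊗ₖ K l) * ((1 : Matrix C C ℂ) ⊗ₖ J) =
      if l = none then 1 else 0 := by
    rw [← Matrix.mul_kronecker_mul, Matrix.one_mul]
    rcases l with _ | y
    · simp only [K, Option.elim, hJ, Matrix.one_kronecker_one, if_true]
    · simp [K, Matrix.mul_assoc, hPJ]
  calc ∑ l, ((1 : Matrix C C ℂ) ⊗ₖ K l) * (((1 : Matrix C C ℂ) ⊗ₖ J) * X *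
          ((1 : Matrix C C ℂ) ⊗ₖ J)ᴴ) * ((1 : Matrix C C ℂ) ⊗ₖ K l)ᴴ
      = ∑ l, (((1 : Matrix C C ℂ) ⊗ₖ K l) * ((1 : Matrix C C ℂ) ⊗ₖ J)) * X *
          (((1 : Matrix C C ℂ) ⊗ₖ K l) * ((1 : Matrix C C ℂ) ⊗ₖ J))ᴴ := by
        simp only [Matrix.conjTranspose_mul, Matrix.mul_assoc]
    _ = X := by simp [hKJ]

lemma isState_singlet : IsState singlet :=
  isMaximallyEntangled_singlet.isState

lemma IsMaximallyEntangled.preparable [AddCommGroup X] [Fintype X] [DecidableEq X]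
    {W : Matrix X X ℂ} (hW : IsMaximallyEntangled W) {ρ : Matrix (A × B) (A × B) ℂ}
    (hρ : IsState ρ) (h : Preparable ρ (pureState W)) {τ : Matrix (C × D) (C × D) ℂ}
    (hτ : IsState τ) (hD : Fintype.card D ≤ Fintype.card X) : Preparable ρ τ := by
  obtain ⟨⟨-, d⟩⟩ : Nonempty (C × D) := by
    by_contra hempty
    rw [not_nonempty_iff] at hempty
    simpa [Matrix.trace] using hτ.2
  have : Nonempty D := ⟨d⟩
  obtain ⟨e⟩ := Function.Embedding.nonempty_of_card_le hD
  have hJ : ((selector e)ᴴ)ᴴ * (selector e : Matrix D X ℂ)ᴴ = 1 := by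
    rw [Matrix.conjTranspose_conjTranspose, selector_mul_conjTranspose e.injective]
  have hJ' : ((1 : Matrix C C ℂ) ⊗ₖ (selector e)ᴴ)ᴴ *
      ((1 : Matrix C C ℂ) ⊗ₖ (selector e)ᴴ) = 1 := by
    rw [Matrix.conjTranspose_kronecker, ← Matrix.mul_kronecker_mul, hJ, Matrix.conjTranspose_one,
      Matrix.one_mul, Matrix.one_kronecker_one]
  have hJτ := hτ.conj_isometry hJ'
  obtain ⟨Λ, hΛ, hΛ_eq⟩ := hW.exists_isLOCC_eq hJτ
  obtain ⟨Φ, hΦ, hΦ_eq⟩ := exists_isLOCC_conj_isometry_eq (C := C) hJ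
  have hprep := h.map hρ hW.isState.1.isHermitian (hΛ.comp hΦ)
  rwa [hΛ_eq, hΦ_eq] at hprep

lemma Distillable.preparable {ρ : Matrix (A × B) (A × B) ℂ} (h : Distillable ρ) (hρ : IsState ρ)
    {τ : Matrix (C × D) (C × D) ℂ} (hτ : IsState τ) : Preparable ρ τ := by
  obtain ⟨r, hr⟩ := lt_iSup_iff.1 h
  obtain ⟨hach, hr⟩ := lt_iSup_iff.1 hr
  have hsinglet : Preparable ρ singlet :=
    preparable_of_achievable hρ isState_singlet (EReal.coe_pos.1 hr) hach
  have hcopies := hsinglet.copies hρ isState_singlet (Fintype.card D)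
  rw [show singlet = pureState (Matrix.of (Function.curry singletVec)) from rfl,
    copies_pureState] at hcopies
  refine (isMaximallyEntangled_singlet.pi _).preparable hρ hcopies hτ ?_
  rw [Fintype.card_fun, Fintype.card_fin, Fintype.card_fin]
  exact Nat.lt_two_pow_self.le

end Preparation

section CatalystReuse

/-- The exchange of the outer two of three factors. -/
def swapOuterEquiv (P Q R : Type) : (P × Q) × R ≃ (R × Q) × P :=
  (Equiv.prodComm _ _).trans
    (((Equiv.refl R).prodCongr (Equiv.prodComm P Q)).trans (Equiv.prodAssoc R Q P).symm)

/-- The exchange of the last two of three factors. -/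
def swapLastEquiv (P Q R : Type) : (P × Q) × R ≃ (P × R) × Q :=
  (Equiv.prodAssoc P Q R).trans
    (((Equiv.refl P).prodCongr (Equiv.prodComm Q R)).trans (Equiv.prodAssoc P R Q).symm)

variable {A B C D P Q S T : Type}

/-- Exchange of the outer two of three bipartite systems. -/
def swapOuter (X : Matrix (((P × C) × A) × ((Q × D) × B)) (((P × C) × A) × ((Q × D) × B)) ℂ) :
    Matrix (((A × C) × P) × ((B × D) × Q)) (((A × C) × P) × ((B × D) × Q)) ℂ :=
  relabel (swapOuterEquiv P C A) (swapOuterEquiv Q D B) X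

/-- Exchange of the last two of three bipartite systems. -/
def swapLast (X : Matrix (((P × C) × A) × ((Q × D) × B)) (((P × C) × A) × ((Q × D) × B)) ℂ) :
    Matrix (((P × A) × C) × ((Q × B) × D)) (((P × A) × C) × ((Q × B) × D)) ℂ :=
  relabel (swapLastEquiv P C A) (swapLastEquiv Q D B) X

lemma swapLast_withCatalyst (ρ : Matrix (P × Q) (P × Q) ℂ) (ρ' : Matrix (A × B) (A × B) ℂ)
    (τ : Matrix (C × D) (C × D) ℂ) :
    swapLast (withCatalyst (withCatalyst ρ ρ') τ) = withCatalyst (withCatalyst ρ τ) ρ' :=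
  Matrix.ext fun _ _ => mul_right_comm _ _ _

lemma systemPart_swapOuter_withCatalyst [Fintype P] [Fintype Q]
    (μ : Matrix ((P × C) × (Q × D)) ((P × C) × (Q × D)) ℂ) (ρ : Matrix (A × B) (A × B) ℂ) :
    systemPart (swapOuter (withCatalyst μ ρ)) = withCatalyst ρ (catalystPart μ) := by
  ext x y
  change ∑ p, ∑ q, μ ((p, x.1.2), (q, x.2.2)) ((p, y.1.2), (q, y.2.2)) *
    ρ (x.1.1, x.2.1) (y.1.1, y.2.1) = _
  simp only [mul_comm _ (ρ _ _), ← Finset.mul_sum]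
  rfl

lemma sum_comm_pairs [Fintype A] [Fintype B] [Fintype C] [Fintype D] (f : A → B → C → D → ℂ) :
    ∑ a, ∑ b, ∑ c, ∑ d, f a b c d = ∑ c, ∑ d, ∑ a, ∑ b, f a b c d := by
  simpa only [Fintype.sum_prod_type] using
    Finset.sum_comm (s := .univ) (t := .univ) (f := fun (x : A × B) (y : C × D) =>
      f x.1 x.2 y.1 y.2)

variable (X : Matrix (((P × C) × A) × ((Q × D) × B)) (((P × C) × A) × ((Q × D) × B)) ℂ)

lemma catalystPart_swapOuter [Fintype A] [Fintype B] [Fintype C] [Fintype D] :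
    catalystPart (swapOuter X) = systemPart (systemPart X) := by
  ext x y
  simp only [catalystPart, systemPart, Fintype.sum_prod_type_right]
  exact Finset.sum_congr rfl fun _ _ => Finset.sum_comm

lemma systemPart_systemPart_swapOuter [Fintype P] [Fintype Q] [Fintype C] [Fintype D] :
    systemPart (systemPart (swapOuter X)) = catalystPart X :=
  (catalystPart_swapOuter (swapOuter X)).symm

lemma catalystPart_systemPart_swapOuter [Fintype A] [Fintype B] [Fintype P] [Fintype Q] :
    catalystPart (systemPart (swapOuter X)) = catalystPart (systemPart X) :=
  Matrix.ext fun _ _ => sum_comm_pairs _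

lemma catalystPart_swapLast [Fintype A] [Fintype B] [Fintype P] [Fintype Q] :
    catalystPart (swapLast X) = catalystPart (systemPart X) := by
  ext x y
  simp only [catalystPart, systemPart, Fintype.sum_prod_type]
  exact Finset.sum_congr rfl fun _ _ => Finset.sum_comm

lemma systemPart_systemPart_swapLast [Fintype A] [Fintype B] [Fintype C] [Fintype D] :
    systemPart (systemPart (swapLast X)) = systemPart (systemPart X) :=
  Matrix.ext fun _ _ => sum_comm_pairs _

lemma catalystPart_systemPart_swapLast [Fintype P] [Fintype Q] [Fintype C] [Fintype D] :
    catalystPart (systemPart (swapLast X)) = catalystPart X :=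
  (catalystPart_swapLast (swapLast X)).symm

end CatalystReuse

section Reuse

variable {A B C D P Q S T : Type} [Fintype A] [DecidableEq A] [Fintype B] [DecidableEq B]
  [Fintype C] [DecidableEq C] [Fintype D] [DecidableEq D]
  [Fintype P] [DecidableEq P] [Fintype Q] [DecidableEq Q]
  [Fintype S] [DecidableEq S] [Fintype T] [DecidableEq T]

-- A second run of `Λ`, on the fresh input `ρ` and the catalyst left over in the output `μ` of the
-- first run, with which it may be correlated.
lemma exists_isLOCC_reuse
    {Λ : Matrix ((A × C) × (B × D)) ((A × C) × (B × D)) ℂ →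
      Matrix ((S × C) × (T × D)) ((S × C) × (T × D)) ℂ} (h : IsLOCC Λ)
    {ρ : Matrix (A × B) (A × B) ℂ} (hρ : ρ.trace = 1) :
    ∃ Φ : Matrix (((P × C) × A) × ((Q × D) × B)) (((P × C) × A) × ((Q × D) × B)) ℂ →
        Matrix (((P × S) × C) × ((Q × T) × D)) (((P × S) × C) × ((Q × T) × D)) ℂ,
      IsLOCC Φ ∧ ∀ μ,
        catalystPart (Φ (withCatalyst μ ρ)) =
          catalystPart (Λ (withCatalyst ρ (catalystPart μ))) ∧
        systemPart (systemPart (Φ (withCatalyst μ ρ))) = systemPart μ ∧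
        catalystPart (systemPart (Φ (withCatalyst μ ρ))) =
          systemPart (Λ (withCatalyst ρ (catalystPart μ))) := by
  refine ⟨fun X => swapLast (swapOuter (withIdle P Q Λ (swapOuter X))),
    (((IsLOCC.relabel _ _).comp (h.withIdle P Q)).comp (IsLOCC.relabel _ _)).comp
      (IsLOCC.relabel _ _), fun μ => ⟨?_, ?_, ?_⟩⟩
  · rw [catalystPart_swapLast, catalystPart_systemPart_swapOuter, systemPart_withIdle h,
      systemPart_swapOuter_withCatalyst]
  · rw [systemPart_systemPart_swapLast, systemPart_systemPart_swapOuter, catalystPart_withIdle h,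
      catalystPart_swapOuter, systemPart_withCatalyst _ hρ]
  · rw [catalystPart_systemPart_swapLast, catalystPart_swapOuter, systemPart_withIdle h,
      systemPart_swapOuter_withCatalyst]

end Reuse

section Iteration

variable {A B A' B' C D : Type} [Fintype A] [DecidableEq A] [Fintype B] [DecidableEq B]
  [Fintype A'] [DecidableEq A'] [Fintype B'] [DecidableEq B']
  [Fintype C] [DecidableEq C] [Fintype D] [DecidableEq D]
  {ρ : Matrix (A × B) (A × B) ℂ} {τ : Matrix (C × D) (C × D) ℂ}

lemma exists_isLOCC_append {n₁ n₂ m₁ m₂ : ℕ} (hρ : IsState ρ)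
    {Λ₁ : Matrix (((Fin n₁ → A) × C) × ((Fin n₁ → B) × D))
        (((Fin n₁ → A) × C) × ((Fin n₁ → B) × D)) ℂ →
      Matrix (((Fin m₁ → A') × C) × ((Fin m₁ → B') × D))
        (((Fin m₁ → A') × C) × ((Fin m₁ → B') × D)) ℂ} (h₁ : IsLOCC Λ₁)
    {Λ₂ : Matrix (((Fin n₂ → A) × C) × ((Fin n₂ → B) × D))
        (((Fin n₂ → A) × C) × ((Fin n₂ → B) × D)) ℂ →
      Matrix (((Fin m₂ → A') × C) × ((Fin m₂ → B') × D))
        (((Fin m₂ → A') × C) × ((Fin m₂ → B') × D)) ℂ} (h₂ : IsLOCC Λ₂)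
    (hτ : catalystPart (Λ₁ (withCatalyst (copies ρ n₁) τ)) = τ) :
    ∃ Λ : Matrix (((Fin (n₁ + n₂) → A) × C) × ((Fin (n₁ + n₂) → B) × D))
          (((Fin (n₁ + n₂) → A) × C) × ((Fin (n₁ + n₂) → B) × D)) ℂ →
        Matrix (((Fin (m₁ + m₂) → A') × C) × ((Fin (m₁ + m₂) → B') × D))
          (((Fin (m₁ + m₂) → A') × C) × ((Fin (m₁ + m₂) → B') × D)) ℂ,
      IsLOCC Λ ∧
      catalystPart (Λ (withCatalyst (copies ρ (n₁ + n₂)) τ)) =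
        catalystPart (Λ₂ (withCatalyst (copies ρ n₂) τ)) ∧
      (∀ i, marginal (systemPart (Λ (withCatalyst (copies ρ (n₁ + n₂)) τ))) (Fin.castAdd m₂ i) =
        marginal (systemPart (Λ₁ (withCatalyst (copies ρ n₁) τ))) i) ∧
      ∀ i, marginal (systemPart (Λ (withCatalyst (copies ρ (n₁ + n₂)) τ))) (Fin.natAdd m₁ i) =
        marginal (systemPart (Λ₂ (withCatalyst (copies ρ n₂) τ))) i := by
  obtain ⟨Φ, hΦ, hΦ_eq⟩ := exists_isLOCC_reuse (P := Fin m₁ → A') (Q := Fin m₁ → B') h₂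
    (hρ.copies n₂).2
  obtain ⟨hcatalyst, hfirst, hsecond⟩ := hΦ_eq (Λ₁ (withCatalyst (copies ρ n₁) τ))
  rw [hτ] at hcatalyst hsecond
  have hsplit := IsLOCC.relabel (Fin.appendEquiv (α := A) n₁ n₂).symm
    (Fin.appendEquiv (α := B) n₁ n₂).symm
  have hmerge := IsLOCC.relabel (Fin.appendEquiv (α := A') m₁ m₂)
    (Fin.appendEquiv (α := B') m₁ m₂)
  have hΛ := ((((hsplit.withIdle C D).comp (IsLOCC.relabel (swapLastEquiv _ _ _)
    (swapLastEquiv _ _ _))).comp (h₁.withIdle _ _)).comp hΦ).comp (hmerge.withIdle C D)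
  refine ⟨fun X => withIdle C D (relabel (Fin.appendEquiv m₁ m₂) (Fin.appendEquiv m₁ m₂))
    (Φ (withIdle _ _ Λ₁ (swapLast (withIdle C D (relabel (Fin.appendEquiv n₁ n₂).symm
      (Fin.appendEquiv n₁ n₂).symm) X)))), hΛ, ?_⟩
  simp only [withIdle_withCatalyst hsplit, relabel_symm_copies_add, swapLast_withCatalyst,
    withIdle_withCatalyst h₁, systemPart_withIdle hmerge, catalystPart_withIdle hmerge]
  refine ⟨hcatalyst, fun i => ?_, fun i => ?_⟩
  · rw [marginal_relabel_append_castAdd, hfirst]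
  · rw [marginal_relabel_append_natAdd, hsecond]

lemma exists_isLOCC_iterate {n m : ℕ} (hρ : IsState ρ)
    {Λ : Matrix (((Fin n → A) × C) × ((Fin n → B) × D)) (((Fin n → A) × C) × ((Fin n → B) × D)) ℂ →
      Matrix (((Fin m → A') × C) × ((Fin m → B') × D))
        (((Fin m → A') × C) × ((Fin m → B') × D)) ℂ} (h : IsLOCC Λ)
    (hτ : catalystPart (Λ (withCatalyst (copies ρ n) τ)) = τ) (k : ℕ) :
    ∃ M : Matrix (((Fin (n * k) → A) × C) × ((Fin (n * k) → B) × D))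
          (((Fin (n * k) → A) × C) × ((Fin (n * k) → B) × D)) ℂ →
        Matrix (((Fin (m * k) → A') × C) × ((Fin (m * k) → B') × D))
          (((Fin (m * k) → A') × C) × ((Fin (m * k) → B') × D)) ℂ,
      IsLOCC M ∧ catalystPart (M (withCatalyst (copies ρ (n * k)) τ)) = τ ∧
      ∀ i, ∃ j, marginal (systemPart (M (withCatalyst (copies ρ (n * k)) τ))) i =
        marginal (systemPart (Λ (withCatalyst (copies ρ n) τ))) j := by
  induction k with
  | zero =>
    have hempty := IsLOCC.relabel (Equiv.ofUnique (Fin 0 → A) (Fin 0 → A'))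
      (Equiv.ofUnique (Fin 0 → B) (Fin 0 → B'))
    refine ⟨_, hempty.withIdle C D, ?_, fun i => Fin.elim0 i⟩
    rw [catalystPart_withIdle hempty]
    exact catalystPart_withCatalyst (hρ.copies 0).2 τ
  | succ k ih =>
    obtain ⟨M, hM, hMτ, hM_marginal⟩ := ih
    obtain ⟨Φ, hΦ, hΦτ, hΦ_castAdd, hΦ_natAdd⟩ := exists_isLOCC_append hρ hM h hMτ
    refine ⟨Φ, hΦ, hΦτ.trans hτ, fun i => ?_⟩
    cases i using Fin.addCases (m := m * k) (n := m) with
    | left i => exact (hM_marginal i).imp fun j hj => (hΦ_castAdd i).trans hj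
    | right i => exact ⟨i, hΦ_natAdd i⟩

end Iteration

section Rates

lemma exists_lt_mul_div_add {r δ : ℝ} {m n : ℕ} (n₀ : ℕ) (hn : 0 < n)
    (h : r < (m : ℝ) / n + δ) :
    ∃ k : ℕ, 0 < n * k + n₀ ∧ r < ((m * k : ℕ) : ℝ) / ((n * k + n₀ : ℕ) : ℝ) + δ := by
  have hn' : (n : ℝ) ≠ 0 := by positivity
  have hlim : Filter.Tendsto (fun k : ℕ => (m : ℝ) / (n + n₀ / k)) Filter.atTop (nhds (m / n)) := by
    have hdenom := (tendsto_const_div_atTop_nhds_zero_nat (n₀ : ℝ)).const_add (n : ℝ)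
    rw [add_zero] at hdenom
    exact tendsto_const_nhds.div hdenom hn'
  obtain ⟨k, hk, hk0⟩ := ((hlim.add_const δ).eventually_const_lt h |>.and
    (Filter.eventually_gt_atTop 0)).exists
  refine ⟨k, by positivity, ?_⟩
  have hk' : (k : ℝ) ≠ 0 := by positivity
  have hrate : ((m * k : ℕ) : ℝ) / ((n * k + n₀ : ℕ) : ℝ) = m / (n + n₀ / k) := by
    push_cast
    field_simp
  rwa [hrate]

lemma IsLOCC.traceNorm_withCatalyst_sub_le {I J C D S T : Type} [Fintype I] [DecidableEq I]
    [Fintype J] [DecidableEq J] [Fintype C] [DecidableEq C] [Fintype D] [DecidableEq D]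
    [Fintype S] [DecidableEq S] [Fintype T] [DecidableEq T]
    {F : Matrix ((I × C) × (J × D)) ((I × C) × (J × D)) ℂ → Matrix (S × T) (S × T) ℂ}
    (hF : IsLOCC F) {ρ : Matrix (I × J) (I × J) ℂ} (hρ : IsState ρ)
    {τ τ' : Matrix (C × D) (C × D) ℂ} (hτ : IsState τ) (hτ' : IsState τ')
    {σ : Matrix (S × T) (S × T) ℂ} (hσ : σ.IsHermitian) :
    traceNorm (F (withCatalyst ρ τ) - σ) ≤
      traceNorm (τ - τ') + traceNorm (F (withCatalyst ρ τ') - σ) := by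
  have hX := hρ.withCatalyst hτ
  have hX' := hρ.withCatalyst hτ'
  have hcatalyst := LOCCRates.traceNorm_withCatalyst_sub_le hρ.1.isHermitian hρ hτ hτ'.1.isHermitian
  rw [sub_self, traceNorm_zero, zero_add] at hcatalyst
  rw [← sub_add_sub_cancel (F (withCatalyst ρ τ)) (F (withCatalyst ρ τ')) σ]
  refine (traceNorm_add_le ((hF.isState hX).1.isHermitian.sub (hF.isState hX').1.isHermitian)
    ((hF.isState hX').1.isHermitian.sub hσ)).trans (add_le_add_left ?_ _)
  exact (hF.traceNorm_sub_le hX.1.isHermitian hX'.1.isHermitian).trans hcatalyst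

variable {A B A' B' : Type} [Fintype A] [DecidableEq A] [Fintype B] [DecidableEq B]
  [Fintype A'] [DecidableEq A'] [Fintype B'] [DecidableEq B']
  {ρ : Matrix (A × B) (A × B) ℂ} {σ : Matrix (A' × B') (A' × B') ℂ} {r : ℝ}

lemma MarginalAchievable.marginalCatalyticAchievable (h : MarginalAchievable ρ σ r)
    (hρ : IsState ρ) : MarginalCatalyticAchievable ρ σ r := by
  intro ε hε δ hδ
  obtain ⟨m, n, hn, Λ, hΛ, hm, hr⟩ := h ε hε δ hδ
  have hτ : IsState (1 : Matrix (Fin 1 × Fin 1) (Fin 1 × Fin 1) ℂ) :=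
    ⟨Matrix.PosSemidef.one, by simp⟩
  refine ⟨m, n, hn, 1, 1, 1, hτ, _, hΛ.withIdle _ _, ?_, ?_, hr⟩
  · rwa [systemPart_withIdle hΛ, systemPart_withCatalyst _ hτ.2]
  · rw [catalystPart_withIdle hΛ, catalystPart_withCatalyst (hρ.copies n).2]

lemma MarginalCatalyticAchievable.marginalAchievable (h : MarginalCatalyticAchievable ρ σ r)
    (hρ : IsState ρ) (hd : Distillable ρ) (hσ : σ.IsHermitian) : MarginalAchievable ρ σ r := by
  intro ε hε δ hδ
  obtain ⟨m, n, hn, c, d, τ, hτ, Λ, hΛ, hm, hcat, hr⟩ := h (ε / 2) (half_pos hε) δ hδ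
  obtain ⟨n₀, P, hP, hPτ⟩ := hd.preparable hρ hτ (ε / 2) (half_pos hε)
  obtain ⟨k, hk, hkr⟩ := exists_lt_mul_div_add n₀ hn hr
  obtain ⟨M, hM, -, hM_marginal⟩ := exists_isLOCC_iterate hρ hΛ hcat k
  obtain ⟨G, hG, hG_eq⟩ := (IsLOCC.done (A' := Fin (n * k) → A)
    (B' := Fin (n * k) → B)).exists_withCatalyst hP
  refine ⟨m * k, n * k + n₀, hk, _, (((IsLOCC.relabel (Fin.appendEquiv (n * k) n₀).symm
    (Fin.appendEquiv (n * k) n₀).symm).comp hG).comp hM).comp IsLOCC.systemPart, fun i => ?_, hkr⟩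
  rw [relabel_symm_copies_add, hG_eq]
  obtain ⟨j, hj⟩ := hM_marginal i
  have hMi := (hM.comp IsLOCC.systemPart).comp (IsLOCC.marginal i)
  have herror := hMi.traceNorm_withCatalyst_sub_le (hρ.copies (n * k))
    (hP.isState (hρ.copies n₀)) hτ hσ
  rw [hj] at herror
  exact herror.trans_lt (by linarith [hm j])

theorem mainTheorem3_general (hρ : IsState ρ) (hd : Distillable ρ) (hσ : IsState σ) :
    marginalCatalyticRate ρ σ = marginalRate ρ σ := by
  have hiff (r : ℝ) : MarginalCatalyticAchievable ρ σ r ↔ MarginalAchievable ρ σ r :=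
    ⟨fun h => h.marginalAchievable hρ hd hσ.1.isHermitian,
      fun h => h.marginalCatalyticAchievable hρ⟩
  simp only [marginalCatalyticRate, marginalRate, hiff]

end Rates

end LOCCRates

theorem mainTheorem3 {A B A' B' : Type} [Fintype A] [DecidableEq A] [Fintype B] [DecidableEq B]
    [Fintype A'] [DecidableEq A'] [Fintype B'] [DecidableEq B']
    (ρ : Matrix (A × B) (A × B) ℂ) (hρ : LOCCRates.IsState ρ)
    (σ : Matrix (A' × B') (A' × B') ℂ) (hσ : LOCCRates.IsState σ)
    (hρd : LOCCRates.Distillable ρ) (hσd : LOCCRates.Distillable σ) :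
    LOCCRates.marginalCatalyticRate ρ σ = LOCCRates.marginalRate ρ σ :=
  LOCCRates.mainTheorem3_general hρ hρd hσ
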